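/- Let $\mathcal{A}$ and $\mathcal{B}$ be abelian categories, assume that $\mathcal{A}$ has enough injectives, and let $F:\mathcal{A}\to\mathcal{B}$ be an additive, left exact functor. Let $Q$ be a finite quiver (finitely many vertices and finitely many arrows), and let $\mathcal{Q}$ be the category generated by $Q$: its objects are the vertices and its morphisms are the paths. Write $\mathcal{Q}(\mathcal{A})$ for the abelian category of functors $\mathcal{Q}\to\mathcal{A}$ and natural transformations, and $F_{\mathcal{Q}}:\mathcal{Q}(\mathcal{A})\to\mathcal{Q}(\mathcal{B})$, $G\mapsto F\circ G$, for the functor induced by $F$. Let $RF:D^+(\mathcal{A})\to D^+(\mathcal{B})$ be the right derived functor of $F$. Then $F_{\mathcal{Q}}$ has a right derived functor $R(F_{\mathcal{Q}}):D^+(\mathcal{Q}(\mathcal{A}))\to D^+(\mathcal{Q}(\mathcal{B}))$ (in the sense of the universal property, hence unique up to isomorphism), and the following hold. (1) If $RF:D^+(\mathcal{A})\to D^+(\mathcal{B})$ is an equivalence of categories, then $R(F_{\mathcal{Q}}):D^+(\mathcal{Q}(\mathcal{A}))\to D^+(\mathcal{Q}(\mathcal{B}))$ is an equivalence of categories. (2)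 Regard $D^b$ as the full subcategory of $D^+$ of objects with bounded cohomology. If $RF$ maps $D^b(\mathcal{A})$ into $D^b(\mathcal{B})$ and the induced functor $D^b(\mathcal{A})\to D^b(\mathcal{B})$ is an equivalence of categories, then $R(F_{\mathcal{Q}})$ maps $D^b(\mathcal{Q}(\mathcal{A}))$ into $D^b(\mathcal{Q}(\mathcal{B}))$ and the induced functor $D^b(\mathcal{Q}(\mathcal{A}))\to D^b(\mathcal{Q}(\mathcal{B}))$ is an equivalence of categories. -/

import Mathlib

open CategoryTheory Limits

/-- The category of representations of the quiver `V` in `A`: functors to `A` from the category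
generated by `V` (objects are the vertices, morphisms are the paths), with natural
transformations as morphisms. -/
abbrev QuiverRep (V : Type*) [Quiver V] (A : Type*) [Category* A] := Paths V ⥤ A

/-- The functor between categories of quiver representations induced by `F : A ⥤ B`, which is
given by composition with `F`. -/
abbrev CategoryTheory.Functor.quiverRep {A B : Type*} [Category* A] [Category* B] (F : A ⥤ B)
    (V : Type*) [Quiver V] : QuiverRep V A ⥤ QuiverRep V B :=
  (Functor.whiskeringRight (Paths V) A B).obj F

/-- `RG : D⁺(C) ⥤ D⁺(D)` is a total right derived functor of the additive functor `G : C ⥤ D`: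
it is equipped with a natural transformation from `K⁺(C) ⥤ K⁺(D) ⥤ D⁺(D)` to
`K⁺(C) ⥤ D⁺(C) ⥤ D⁺(D)` which is universal. This determines `RG` up to a unique
isomorphism; when `C` has enough injectives, it is the functor which is computed by injective
resolutions. -/
def CategoryTheory.Functor.IsRightDerivedFunctorPlus {C D : Type*} [Category* C] [Category* D]
    [Abelian C] [Abelian D] [HasDerivedCategory C] [HasDerivedCategory D]
    (G : C ⥤ D) [G.Additive] (RG : DerivedCategory.Plus C ⥤ DerivedCategory.Plus D) : Prop :=
  ∃ α : G.mapHomotopyCategoryPlus ⋙ DerivedCategory.Plus.Qh ⟶ DerivedCategory.Plus.Qh ⋙ RG,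
    RG.IsRightDerivedFunctor α (HomotopyCategory.Plus.quasiIso C)

/-- The objects of `D⁺(C)` whose cohomology is bounded; the full subcategory of these objects is
the bounded derived category `Dᵇ(C)`. -/
def DerivedCategory.Plus.bounded (C : Type*) [Category* C] [Abelian C] [HasDerivedCategory C] :
    ObjectProperty (DerivedCategory.Plus C) :=
  fun X => ∃ n : ℤ, X.IsLE n

/-- `G : D⁺(C) ⥤ D⁺(D)` sends `Dᵇ(C)` to `Dᵇ(D)`, and the functor `Dᵇ(C) ⥤ Dᵇ(D)` it induces
is an equivalence of categories. -/
def CategoryTheory.Functor.InducesBoundedEquivalence {C D : Type*} [Category* C] [Category* D]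
    [Abelian C] [Abelian D] [HasDerivedCategory C] [HasDerivedCategory D]
    (G : DerivedCategory.Plus C ⥤ DerivedCategory.Plus D) : Prop :=
  ∃ h : ∀ X, DerivedCategory.Plus.bounded C X → DerivedCategory.Plus.bounded D (G.obj X),
    ((DerivedCategory.Plus.bounded D).lift ((DerivedCategory.Plus.bounded C).ι ⋙ G)
      (fun X => h X.obj X.property)).IsEquivalence

/-!
Let `RF` be the right derived functor of `F`. An object of `A` is *acyclic* when `RF` sends it to
an object concentrated in degree `0`. The category of representations of a quiver `V` in `A` need
not have injectives which are easy to handle when `V` has cycles, so that derived functors are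
computed with complexes of representations that are acyclic at each vertex. As there are no
relations between the arrows of a quiver, such resolutions exist
(`QuiverRep.exists_quasiIso_injective`): choose monomorphisms to injective resolutions at each
vertex, and extend the action of the arrows one by one. The functor induced by `F` preserves
quasi-isomorphisms between complexes that are acyclic at each vertex, which gives the existence
of its right derived functor, and the fact that any right derived functor is computed by
these complexes (`LocalizerMorphism.isRightDerivabilityStructure_of_hasRightResolutions`).

Assume now that `RF` is an equivalence on `D⁺` or on `Dᵇ`. Both cases are treated at once, with a
proposition `p` which tells whether the objects under consideration are required to be bounded
(`IsDerivedEquivalence`). The functor `F` is fully faithful on acyclic objects, and hence so is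
the induced functor on (complexes of) representations which are acyclic at each vertex. Moreover,
on these complexes, quasi-isomorphisms can be detected after applying `F`, because this can be
checked at each vertex. By calculus of fractions
(`RestrictsToEquivalence.of_localization`), it remains to show that any complex `Y` of
representations in `B` receives a quasi-isomorphism from the image by `F` of a complex of
representations which are acyclic at each vertex (`exists_quasiIso_mapCochainComplexPlus`).

For this, say that an object of `B` has *amplitude* `k` when it corresponds under `RF` to an object
in degrees `≥ -k`. The objects of amplitude `0` are the images of acyclic objects. Every
object `X` of `B` is a quotient of the image by `F` of an acyclic object, namely the
cycles in degree `0` of a complex of injectives that corresponds to `X`, and this depends on `X` in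
a weakly functorial way (`exists_cover`), so that representations can be covered too.
The kernel of such a cover has a smaller amplitude (`amplitude_X₁`). Hence, complexes with terms
of bounded amplitude have the expected left resolutions
(`CochainComplex.exists_quasiIso_of_objectProperty`). Bounded complexes involve only finitely many
objects at finitely many vertices; in the unbounded case, an infinite direct sum of
shifts shows that all the objects of `B` have uniformly bounded amplitude
(`exists_amplitude_bound`).
-/

open DerivedCategory Pretriangulated ZeroObject

/-! ### Localizer morphisms given by fully faithful functors with resolutions -/

namespace CategoryTheory.LocalizerMorphism

variable {C₁ C₂ : Type*} [Category* C₁] [Category* C₂]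
  {W₁ : MorphismProperty C₁} {W₂ : MorphismProperty C₂}

lemma mem_iff_of_isInduced (Φ : LocalizerMorphism W₁ W₂) [Φ.IsInduced] {X Y : C₁} (f : X ⟶ Y) :
    W₁ f ↔ W₂ (Φ.functor.map f) := by
  conv_lhs => rw [← Φ.inverseImage_eq]
  rfl

lemma hasLeftCalculusOfFractions_of_hasRightResolutions (Φ : LocalizerMorphism W₁ W₂)
    [Φ.functor.Full] [Φ.functor.Faithful] [Φ.IsInduced] [Φ.HasRightResolutions]
    [W₂.HasLeftCalculusOfFractions] : W₁.HasLeftCalculusOfFractions where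
  id_mem X := by
    rw [Φ.mem_iff_of_isInduced, Functor.map_id]
    exact W₂.id_mem _
  comp_mem f g hf hg := by
    rw [Φ.mem_iff_of_isInduced] at hf hg ⊢
    rw [Functor.map_comp]
    exact W₂.comp_mem _ _ hf hg
  exists_leftFraction X Y φ := by
    obtain ⟨ψ, hψ⟩ := (MorphismProperty.RightFraction.mk (W := W₂) (Φ.functor.map φ.s)
      (Φ.map _ φ.hs) (Φ.functor.map φ.f)).exists_leftFraction
    let R : Φ.RightResolution ψ.Y' := Classical.arbitrary _
    refine ⟨⟨Φ.functor.preimage (ψ.f ≫ R.w), Φ.functor.preimage (ψ.s ≫ R.w), ?_⟩, ?_⟩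
    · rw [Φ.mem_iff_of_isInduced, Functor.map_preimage]
      exact W₂.comp_mem _ _ ψ.hs R.hw
    · apply Φ.functor.map_injective
      simpa using hψ =≫ R.w
  ext X' X Y f₁ f₂ s hs h := by
    obtain ⟨Z, t, ht, fac⟩ := MorphismProperty.HasLeftCalculusOfFractions.ext
      (Φ.functor.map f₁) (Φ.functor.map f₂) (Φ.functor.map s) (Φ.map _ hs)
      (by simp only [← Functor.map_comp, h])
    let R : Φ.RightResolution Z := Classical.arbitrary _
    refine ⟨R.X₁, Φ.functor.preimage (t ≫ R.w), ?_, ?_⟩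
    · rw [Φ.mem_iff_of_isInduced, Functor.map_preimage]
      exact W₂.comp_mem _ _ ht R.hw
    · apply Φ.functor.map_injective
      simpa using fac =≫ R.w

/-- A full subcategory in which every object has a right resolution has the same localization as the
ambient category: left fractions in the ambient category can be extended so that their middle
term belongs to the subcategory. -/
lemma isLocalizedEquivalence_of_hasRightResolutions (Φ : LocalizerMorphism W₁ W₂)
    [Φ.functor.Full] [Φ.functor.Faithful] [Φ.IsInduced] [Φ.HasRightResolutions]
    [W₂.HasLeftCalculusOfFractions] : Φ.IsLocalizedEquivalence := by
  have := Φ.hasLeftCalculusOfFractions_of_hasRightResolutions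
  let G := Φ.localizedFunctor W₁.Q W₂.Q
  let e : Φ.functor ⋙ W₂.Q ≅ W₁.Q ⋙ G := CatCommSq.iso Φ.functor W₁.Q W₂.Q G
  have : (Φ.functor ⋙ W₂.Q).EssSurj := Φ.essSurj_of_hasRightResolutions W₂.Q
  have : (W₁.Q ⋙ G).EssSurj := Functor.essSurj_of_iso e
  have : W₁.Q.EssSurj := Localization.essSurj W₁.Q W₁
  have : G.EssSurj :=
    ⟨fun Y ↦ ⟨_, ⟨(W₁.Q ⋙ G).objObjPreimageIso Y⟩⟩⟩
  have : G.Faithful := by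
    refine Functor.faithful_of_comp_of_hasLeftCalculusOfFractions W₁.Q W₁ G (fun X Y f g h ↦ ?_)
    have h' : W₂.Q.map (Φ.functor.map f) = W₂.Q.map (Φ.functor.map g) := by
      rw [← cancel_mono (e.hom.app Y)]
      exact (e.hom.naturality f).trans
        (Eq.trans (congr_arg (e.hom.app X ≫ ·) h) (e.hom.naturality g).symm)
    rw [MorphismProperty.map_eq_iff_postcomp W₂.Q W₂] at h'
    obtain ⟨Z, s, hs, fac⟩ := h'
    let R : Φ.RightResolution Z := Classical.arbitrary _
    rw [MorphismProperty.map_eq_iff_postcomp W₁.Q W₁]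
    refine ⟨R.X₁, Φ.functor.preimage (s ≫ R.w), ?_, ?_⟩
    · rw [Φ.mem_iff_of_isInduced, Functor.map_preimage]
      exact W₂.comp_mem _ _ hs R.hw
    · apply Φ.functor.map_injective
      simpa using fac =≫ R.w
  have : G.Full := by
    refine G.full_of_comp_essSurj W₁.Q (fun X Y φ ↦ ?_)
    let φ' : W₂.Q.obj (Φ.functor.obj X) ⟶ W₂.Q.obj (Φ.functor.obj Y) :=
      e.hom.app X ≫ φ ≫ e.inv.app Y
    obtain ⟨f, hf⟩ := Localization.exists_leftFraction W₂.Q W₂ φ'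
    let R : Φ.RightResolution f.Y' := Classical.arbitrary _
    let a := Φ.functor.preimage (f.f ≫ R.w)
    let s := Φ.functor.preimage (f.s ≫ R.w)
    have hs : W₁ s := by
      rw [Φ.mem_iff_of_isInduced, Functor.map_preimage]
      exact W₂.comp_mem _ _ f.hs R.hw
    have := Localization.inverts W₁.Q W₁ s hs
    refine ⟨W₁.Q.map a ≫ CategoryTheory.inv (W₁.Q.map s), ?_⟩
    have h₁ : φ' ≫ W₂.Q.map (Φ.functor.map s) = W₂.Q.map (Φ.functor.map a) := by
      simp only [a, s, Functor.map_preimage, Functor.map_comp]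
      rw [hf, MorphismProperty.LeftFraction.map_comp_map_s_assoc]
    have h₂ : φ ≫ G.map (W₁.Q.map s) = G.map (W₁.Q.map a) := by
      have n₁ : W₂.Q.map (Φ.functor.map s) ≫ e.hom.app _ =
        e.hom.app Y ≫ G.map (W₁.Q.map s) := e.hom.naturality s
      have n₂ : W₂.Q.map (Φ.functor.map a) ≫ e.hom.app _ =
        e.hom.app X ≫ G.map (W₁.Q.map a) := e.hom.naturality a
      rw [← cancel_epi (e.hom.app X), ← n₂, ← h₁, Category.assoc, n₁]
      have : e.inv.app Y ≫ e.hom.app Y = 𝟙 _ := e.inv_hom_id_app Y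
      simp only [φ', Category.assoc]
      erw [reassoc_of% this]
    rw [Functor.map_comp, ← h₂, Category.assoc, ← Functor.map_comp, IsIso.hom_inv_id,
      Functor.map_id, Category.comp_id]
  have : G.IsEquivalence := { }
  exact IsLocalizedEquivalence.mk' Φ W₁.Q W₂.Q G

/-- By the calculus of left fractions, any two right resolutions of an object are dominated by a
third one. -/
lemma isConnected_rightResolution (Φ : LocalizerMorphism W₁ W₂)
    [Φ.functor.Full] [Φ.HasRightResolutions]
    [W₂.HasLeftCalculusOfFractions] (X : C₂) : IsConnected (Φ.RightResolution X) := by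
  refine zigzag_isConnected (fun R₁ R₂ ↦ ?_)
  obtain ⟨ψ, hψ⟩ := (MorphismProperty.RightFraction.mk (W := W₂) R₁.w R₁.hw
    R₂.w).exists_leftFraction
  dsimp at hψ
  let R : Φ.RightResolution ψ.Y' := Classical.arbitrary _
  let R₃ : Φ.RightResolution X := RightResolution.mk (R₂.w ≫ ψ.s ≫ R.w)
    (W₂.comp_mem _ _ R₂.hw (W₂.comp_mem _ _ ψ.hs R.hw))
  let f₁ : R₁ ⟶ R₃ :=
    { f := Φ.functor.preimage (ψ.f ≫ R.w)
      comm := by simp [R₃, reassoc_of% hψ] }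
  let f₂ : R₂ ⟶ R₃ :=
    { f := Φ.functor.preimage (ψ.s ≫ R.w)
      comm := by simp [R₃] }
  exact (Zigzag.of_hom f₁).trans (Zigzag.of_inv f₂)

lemma hasRightResolutions_arrow (Φ : LocalizerMorphism W₁ W₂)
    [Φ.functor.Full] [Φ.HasRightResolutions]
    [W₂.HasLeftCalculusOfFractions] : Φ.arrow.HasRightResolutions := fun f ↦ by
  let R₁ : Φ.RightResolution f.left := Classical.arbitrary _
  obtain ⟨ψ, hψ⟩ := (MorphismProperty.RightFraction.mk (W := W₂) R₁.w R₁.hw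
    f.hom).exists_leftFraction
  dsimp at hψ
  let R : Φ.RightResolution ψ.Y' := Classical.arbitrary _
  exact ⟨{
    X₁ := Arrow.mk (Φ.functor.preimage (ψ.f ≫ R.w))
    w := Arrow.homMk R₁.w (ψ.s ≫ R.w) (by
      change R₁.w ≫ Φ.functor.map (Φ.functor.preimage (ψ.f ≫ R.w)) = _
      rw [Functor.map_preimage]
      exact (reassoc_of% hψ) R.w |>.symm)
    hw := ⟨R₁.hw, W₂.comp_mem _ _ ψ.hs R.hw⟩ }⟩

/-- The inclusion of a full subcategory is a right derivability structure as soon as the ambient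
class of morphisms has a left calculus of fractions and every object has a right resolution: by
the calculus of fractions, two resolutions of an object are dominated by a third one, and
morphisms lift to resolutions. -/
lemma isRightDerivabilityStructure_of_hasRightResolutions (Φ : LocalizerMorphism W₁ W₂)
    [Φ.functor.Full] [Φ.functor.Faithful] [Φ.IsInduced] [Φ.HasRightResolutions]
    [W₂.HasLeftCalculusOfFractions] : Φ.IsRightDerivabilityStructure := by
  have := Φ.isLocalizedEquivalence_of_hasRightResolutions
  have := Φ.isConnected_rightResolution
  have := Φ.hasRightResolutions_arrow
  exact IsRightDerivabilityStructure.mk' Φ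

end CategoryTheory.LocalizerMorphism

/-! ### Right derived functors are triangulated -/

namespace CategoryTheory

variable {A B : Type*} [Category* A] [Category* B] [Abelian A] [Abelian B]
  [HasDerivedCategory A] [HasDerivedCategory B]

namespace InjectiveObject

/-- The functor from the bounded below homotopy category of injective objects to the bounded
below derived category. -/
noncomputable abbrev toDerivedPlus (A : Type*) [Category* A] [Abelian A] [HasDerivedCategory A] :
    HomotopyCategory.Plus (InjectiveObject A) ⥤ DerivedCategory.Plus A :=
  (InjectiveObject.ι A).mapHomotopyCategoryPlus ⋙ Plus.Qh

lemma toDerivedPlus_map_bijective (X Y : HomotopyCategory.Plus (InjectiveObject A)) :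
    Function.Bijective ((toDerivedPlus A).map : (X ⟶ Y) → _) := by
  obtain ⟨K, rfl⟩ := HomotopyCategory.Plus.quotient_obj_surjective Y
  exact (Plus.Qh_map_bijective_of_isKInjective _ _
    (inferInstanceAs (CochainComplex.IsKInjective
    (((InjectiveObject.ι A).mapHomologicalComplex (.up ℤ)).obj K.obj)))).comp
    ((Functor.FullyFaithful.ofFullyFaithful
      (InjectiveObject.ι A).mapHomotopyCategoryPlus).map_bijective _ _)

instance : (toDerivedPlus A).Full := ⟨(toDerivedPlus_map_bijective _ _).2⟩

instance : (toDerivedPlus A).Faithful := ⟨fun h ↦ (toDerivedPlus_map_bijective _ _).1 h⟩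

instance [EnoughInjectives A] : (toDerivedPlus A).IsEquivalence where

end InjectiveObject

variable [EnoughInjectives A] (F : A ⥤ B) [F.Additive]

namespace Functor

/-- Right derived functors are computed by complexes of injective objects. -/
noncomputable def toDerivedPlusCompRightDerivedFunctorPlusIso :
    InjectiveObject.toDerivedPlus A ⋙ F.rightDerivedFunctorPlus ≅
      (InjectiveObject.ι A).mapHomotopyCategoryPlus ⋙ F.mapHomotopyCategoryPlus ⋙ Plus.Qh :=
  (NatIso.ofComponents (fun X ↦ asIso (F.rightDerivedFunctorPlusUnit.app
    ((InjectiveObject.ι A).mapHomotopyCategoryPlus.obj X)))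
    (fun f ↦ F.rightDerivedFunctorPlusUnit.naturality
      ((InjectiveObject.ι A).mapHomotopyCategoryPlus.map f))).symm

/-- The right derived functor, expressed with the inverse of the equivalence between the bounded
below homotopy category of injective objects and the bounded below derived category. -/
noncomputable def rightDerivedFunctorPlusIso :
    (InjectiveObject.toDerivedPlus A).asEquivalence.inverse ⋙
      (InjectiveObject.ι A).mapHomotopyCategoryPlus ⋙ F.mapHomotopyCategoryPlus ⋙ Plus.Qh ≅
        F.rightDerivedFunctorPlus :=
  isoWhiskerLeft _ (toDerivedPlusCompRightDerivedFunctorPlusIso F).symm ≪≫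
    (InjectiveObject.toDerivedPlus A).asEquivalence.invFunIdAssoc _

noncomputable instance : (InjectiveObject.toDerivedPlus A).asEquivalence.functor.CommShift ℤ :=
  inferInstanceAs ((InjectiveObject.toDerivedPlus A).CommShift ℤ)

noncomputable instance : (InjectiveObject.toDerivedPlus A).asEquivalence.inverse.CommShift ℤ :=
  (InjectiveObject.toDerivedPlus A).asEquivalence.commShiftInverse ℤ

instance : (InjectiveObject.toDerivedPlus A).asEquivalence.CommShift ℤ :=
  (InjectiveObject.toDerivedPlus A).asEquivalence.commShift_of_functor ℤ

instance : (InjectiveObject.toDerivedPlus A).asEquivalence.IsTriangulated :=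
  Equivalence.IsTriangulated.mk' (InjectiveObject.toDerivedPlus A).asEquivalence
    (inferInstanceAs (InjectiveObject.toDerivedPlus A).IsTriangulated)

noncomputable instance : F.rightDerivedFunctorPlus.CommShift ℤ :=
  Functor.CommShift.ofIso F.rightDerivedFunctorPlusIso ℤ

instance : NatTrans.CommShift F.rightDerivedFunctorPlusIso.hom ℤ :=
  Functor.CommShift.ofIso_compatibility F.rightDerivedFunctorPlusIso ℤ

instance : F.rightDerivedFunctorPlus.IsTriangulated :=
  isTriangulated_of_iso F.rightDerivedFunctorPlusIso

end Functor
end CategoryTheory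

/-! ### Complexes in the bounded below derived category -/

/-- The functor which sends an object `X` to the bounded below cochain complex with `X` sitting
in degree `0`. -/
noncomputable def CochainComplex.Plus.single (C : Type*) [Category* C] [Abelian C] :
    C ⥤ CochainComplex.Plus C :=
  ObjectProperty.lift _ (CochainComplex.singleFunctor C 0) (fun _ ↦ ⟨0, inferInstance⟩)

namespace DerivedCategory.Plus

variable {C : Type*} [Category* C] [Abelian C] [HasDerivedCategory C]

lemma isLE_iff (X : Plus C) (n : ℤ) :
    X.IsLE n ↔ ∀ i, n < i → IsZero ((homologyFunctor C i).obj X) := by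
  rw [← isLE_ι_obj_iff, DerivedCategory.isLE_iff]
  rfl

lemma isLE_Q_obj_iff (K : CochainComplex.Plus C) (n : ℤ) :
    (Q.obj K).IsLE n ↔ K.obj.IsLE n := by
  rw [← isLE_ι_obj_iff, ← DerivedCategory.isLE_Q_obj_iff]
  rfl

lemma isGE_Q_obj_iff (K : CochainComplex.Plus C) (n : ℤ) :
    (Q.obj K).IsGE n ↔ K.obj.IsGE n := by
  rw [← isGE_ι_obj_iff, ← DerivedCategory.isGE_Q_obj_iff]
  rfl

lemma isIso_Q_map_iff {K L : CochainComplex.Plus C} (f : K ⟶ L) :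
    IsIso (Q.map f) ↔ QuasiIso f.hom := by
  rw [← DerivedCategory.isIso_Q_map_iff_quasiIso, ← isIso_iff_of_reflects_iso _ ι]
  rfl

/-- The homology of the image of a complex in the derived category. -/
noncomputable def homologyFunctorFactors (n : ℤ) :
    Q ⋙ homologyFunctor C n ≅
      CochainComplex.Plus.ι C ⋙ HomologicalComplex.homologyFunctor C (.up ℤ) n :=
  Functor.isoWhiskerLeft (CochainComplex.Plus.ι C) (DerivedCategory.homologyFunctorFactors C n)

/-- The homology in degree `0` of a complex in degree `0`. -/
noncomputable def singleFunctorCompHomologyFunctorIso :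
    singleFunctor C 0 ⋙ homologyFunctor C 0 ≅ 𝟭 C :=
  Functor.isoWhiskerLeft (CochainComplex.Plus.single C) (homologyFunctorFactors 0) ≪≫
    HomologicalComplex.homologyFunctorSingleIso C (.up ℤ) 0

lemma exists_distTriang_of_shortExact {S : ShortComplex C} (hS : S.ShortExact) :
    ∃ h, Triangle.mk ((singleFunctor C 0).map S.f) ((singleFunctor C 0).map S.g) h ∈
      distTriang (Plus C) := by
  let δ₀ : (singleFunctor C 0 ⋙ ι).obj S.X₃ ⟶
    (ι ⋙ shiftFunctor (DerivedCategory C) (1 : ℤ)).obj ((singleFunctor C 0).obj S.X₁) := hS.singleδ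
  obtain ⟨δ, hδ⟩ := ι.map_surjective
    (X := (singleFunctor C 0).obj S.X₃) (Y := ((singleFunctor C 0).obj S.X₁)⟦(1 : ℤ)⟧)
    (δ₀ ≫ (ι.commShiftIso (1 : ℤ)).inv.app ((singleFunctor C 0).obj S.X₁))
  refine ⟨δ, ?_⟩
  rw [← ι.map_distinguished_iff]
  refine isomorphic_distinguished _ hS.singleTriangle_distinguished _
    (Triangle.isoMk _ _ (Iso.refl _) (Iso.refl _) (Iso.refl _) ?_ ?_ ?_)
  · exact (Category.comp_id _).trans (Category.id_comp _).symm
  · exact (Category.comp_id _).trans (Category.id_comp _).symm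
  · refine (congr_arg (_ ≫ ·) (CategoryTheory.Functor.map_id _ _)).trans
      ((Category.comp_id _).trans (Eq.trans ?_ (Category.id_comp _).symm))
    exact (Iso.eq_comp_inv ((ι.commShiftIso (1 : ℤ)).app ((singleFunctor C 0).obj S.X₁))).1 hδ

lemma exact_homology {T : Triangle (Plus C)} (hT : T ∈ distTriang _) (n : ℤ) :
    (ShortComplex.mk ((homologyFunctor C n).map T.mor₁) ((homologyFunctor C n).map T.mor₂)
      (by rw [← Functor.map_comp, comp_distTriang_mor_zero₁₂ _ hT, Functor.map_zero])).Exact :=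
  (homologyFunctor C n).map_distinguished_exact _ hT

lemma exists_iso_singleFunctor_obj (X : Plus C) (hX : X.IsGE 0) (hX' : X.IsLE 0) :
    ∃ Y, Nonempty (X ≅ (singleFunctor C 0).obj Y) := by
  obtain ⟨Y, ⟨e⟩⟩ := (ι.obj X).exists_iso_singleFunctor_obj_of_isGE_of_isLE 0
  exact ⟨Y, ⟨ι.preimageIso e⟩⟩

instance : (singleFunctor C 0 ⋙ ι).Full :=
  inferInstanceAs (DerivedCategory.singleFunctor C 0).Full

instance : (singleFunctor C 0 ⋙ ι).Faithful :=
  inferInstanceAs (DerivedCategory.singleFunctor C 0).Faithful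

instance : (singleFunctor C 0).Full := Functor.Full.of_comp_faithful (singleFunctor C 0) ι

instance : (singleFunctor C 0).Faithful := Functor.Faithful.of_comp (singleFunctor C 0) ι

end DerivedCategory.Plus

namespace CategoryTheory.Functor

/-! ### Acyclic objects for a left exact functor -/

/-- If the source of `f` is concentrated in a single degree `j` locally, and its target starts in
degree `j`, then `f` being a quasi-isomorphism in degree `j` means that `f` is a kernel of the
differential of the target, and this is preserved by left exact functors. -/
lemma quasiIsoAt_mapHomologicalComplex_map {A B : Type*} [Category* A] [Category* B] [Abelian A]
    [Abelian B] {F : A ⥤ B} [F.Additive] [PreservesFiniteLimits F] {K L : CochainComplex A ℤ}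
    (f : K ⟶ L) (i j k : ℤ) (hij : i + 1 = j) (hjk : j + 1 = k)
    (h₁ : K.d i j = 0) (h₂ : K.d j k = 0) (h₃ : L.d i j = 0) (hf : QuasiIsoAt f j) :
    QuasiIsoAt ((F.mapHomologicalComplex (.up ℤ)).map f) j := by
  have hi : (ComplexShape.up ℤ).prev j = i := by simp; lia
  have hk : (ComplexShape.up ℤ).next j = k := by simp; lia
  rw [quasiIsoAt_iff' _ i j k hi hk] at hf ⊢
  obtain ⟨h, hm⟩ := (ShortComplex.quasiIso_iff_of_zeros _ h₁ h₂ h₃).1 hf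
  refine (ShortComplex.quasiIso_iff_of_zeros _ ?_ ?_ ?_).2 ⟨?_, ?_⟩
  · exact (congr_arg F.map h₁).trans (F.map_zero _ _)
  · exact (congr_arg F.map h₂).trans (F.map_zero _ _)
  · exact (congr_arg F.map h₃).trans (F.map_zero _ _)
  · exact h.map_of_mono_of_preservesKernel F hm inferInstance
  · have : Mono (f.f j) := hm
    exact inferInstanceAs (Mono (F.map (f.f j)))

variable {A B : Type*} [Category* A] [Category* B] [Abelian A] [Abelian B]
  [HasDerivedCategory A] [HasDerivedCategory B]
variable [EnoughInjectives A] (F : A ⥤ B) [F.Additive]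

/-- The comparison between a functor applied to a complex and the right derived functor. -/
noncomputable def toRightDerivedFunctorPlus :
    F.mapCochainComplexPlus ⋙ Plus.Q ⟶ Plus.Q ⋙ F.rightDerivedFunctorPlus :=
  whiskerLeft (HomotopyCategory.Plus.quotient A) F.rightDerivedFunctorPlusUnit

instance isIso_toRightDerivedFunctorPlus_app_of_injective (K : CochainComplex.Plus A)
    [∀ n, Injective (K.obj.X n)] : IsIso (F.toRightDerivedFunctorPlus.app K) := by
  have : ∀ n, Injective (((HomotopyCategory.Plus.quotient A).obj K).obj.as.X n) := by assumption
  exact inferInstanceAs (IsIso (F.rightDerivedFunctorPlusUnit.app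
    ((HomotopyCategory.Plus.quotient A).obj K)))

instance (L : CochainComplex.Plus (InjectiveObject A)) :
    IsIso (F.toRightDerivedFunctorPlus.app
      ((InjectiveObject.ι A).mapCochainComplexPlus.obj L)) :=
  inferInstanceAs (IsIso (F.rightDerivedFunctorPlusUnit.app
    ((HomotopyCategory.Plus.quotient A).obj
      ((InjectiveObject.ι A).mapCochainComplexPlus.obj L))))

lemma isGE_rightDerivedFunctorPlus_obj (X : DerivedCategory.Plus A) (n : ℤ) (hX : X.IsGE n) :
    (F.rightDerivedFunctorPlus.obj X).IsGE n := by
  obtain ⟨L, hL, ⟨e⟩⟩ := X.exists_injective_nonempty_iso n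
  let K := (InjectiveObject.ι A).mapCochainComplexPlus.obj L
  have : CochainComplex.IsStrictlyGE K.obj n :=
    inferInstanceAs (CochainComplex.IsStrictlyGE
      (((InjectiveObject.ι A).mapHomologicalComplex (.up ℤ)).obj L.obj) n)
  have h : CochainComplex.IsStrictlyGE (F.mapCochainComplexPlus.obj K).obj n :=
    inferInstanceAs (CochainComplex.IsStrictlyGE
      ((F.mapHomologicalComplex (.up ℤ)).obj K.obj) n)
  have : ((F.mapCochainComplexPlus ⋙ Plus.Q).obj K).IsGE n :=
    (Plus.isGE_Q_obj_iff (F.mapCochainComplexPlus.obj K) n).2 inferInstance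
  exact Plus.TStructure.t.isGE_of_iso (asIso (F.toRightDerivedFunctorPlus.app K) ≪≫
    F.rightDerivedFunctorPlus.mapIso e) n

/-- Additive functors commute with the formation of complexes concentrated in degree zero. -/
noncomputable def singleMapCochainComplexPlusIso :
    F ⋙ CochainComplex.Plus.single B ≅ CochainComplex.Plus.single A ⋙ F.mapCochainComplexPlus :=
  NatIso.ofComponents (fun X ↦ ObjectProperty.isoMk _
    ((HomologicalComplex.singleMapHomologicalComplex F (.up ℤ) 0).symm.app X))
    (fun f ↦ by
      ext1
      exact (HomologicalComplex.singleMapHomologicalComplex F (.up ℤ) 0).inv.naturality f)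

/-- The comparison between a functor on objects and its right derived functor. -/
noncomputable def singleToRightDerivedFunctorPlus :
    F ⋙ Plus.singleFunctor B 0 ⟶ Plus.singleFunctor A 0 ⋙ F.rightDerivedFunctorPlus :=
  whiskerRight F.singleMapCochainComplexPlusIso.hom Plus.Q ≫
    whiskerLeft (CochainComplex.Plus.single A) F.toRightDerivedFunctorPlus

/-- The objects whose higher right derived functors vanish. -/
def acyclic (F : A ⥤ B) [F.Additive] : ObjectProperty A :=
  fun X ↦ (F.rightDerivedFunctorPlus.obj ((Plus.singleFunctor A 0).obj X)).IsLE 0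

instance : F.acyclic.IsClosedUnderIsomorphisms where
  of_iso e (_ : Plus.IsLE _ 0) := Plus.TStructure.t.isLE_of_iso
    (F.rightDerivedFunctorPlus.mapIso ((Plus.singleFunctor A 0).mapIso e)) 0

section

variable {F}

lemma acyclic_of_injective (X : A) [Injective X] : F.acyclic X := by
  let K := (CochainComplex.Plus.single A).obj X
  have : ∀ n, Injective (K.obj.X n) := fun n ↦ by
    by_cases hn : n = 0
    · subst hn
      exact Injective.of_iso (HomologicalComplex.singleObjXSelf (.up ℤ) 0 X).symm inferInstance
    · exact Injective.of_iso
        ((HomologicalComplex.isZero_single_obj_X (.up ℤ) 0 X n hn).iso (isZero_zero A)).symm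
        inferInstance
  have : IsIso (F.toRightDerivedFunctorPlus.app K) :=
    F.isIso_toRightDerivedFunctorPlus_app_of_injective K
  have h : IsIso (F.singleToRightDerivedFunctorPlus.app X) := by
    have : IsIso (Plus.Q.map (F.singleMapCochainComplexPlusIso.hom.app X) ≫
        F.toRightDerivedFunctorPlus.app K) := inferInstance
    exact this
  exact Plus.TStructure.t.isLE_of_iso (X := (Plus.singleFunctor B 0).obj (F.obj X))
    (asIso (F.singleToRightDerivedFunctorPlus.app X)) 0

lemma acyclic_of_isZero (X : A) (hX : IsZero X) : F.acyclic X :=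
  F.acyclic.prop_of_iso (((isZero_zero A).iso hX)) (acyclic_of_injective _)

lemma acyclic_X₂ {S : ShortComplex A} (hS : S.ShortExact) (h₁ : F.acyclic S.X₁)
    (h₃ : F.acyclic S.X₃) : F.acyclic S.X₂ := by
  obtain ⟨h, hT⟩ := Plus.exists_distTriang_of_shortExact hS
  exact Plus.TStructure.t.isLE₂ _ (F.rightDerivedFunctorPlus.map_distinguished _ hT) 0 h₁ h₃

lemma acyclic_X₃ {S : ShortComplex A} (hS : S.ShortExact) (h₁ : F.acyclic S.X₁)
    (h₂ : F.acyclic S.X₂) : F.acyclic S.X₃ := by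
  obtain ⟨h, hT⟩ := Plus.exists_distTriang_of_shortExact hS
  have : Plus.TStructure.t.IsLE _ 0 := h₁
  have := Plus.TStructure.t.isLE_shift
    (F.rightDerivedFunctorPlus.obj ((Plus.singleFunctor A 0).obj S.X₁)) 0 1 (-1)
  exact Plus.TStructure.t.isLE₂ _ (rot_of_distTriang _
    (F.rightDerivedFunctorPlus.map_distinguished _ hT)) 0 h₂
    (Plus.TStructure.t.isLE_of_le ((F.rightDerivedFunctorPlus.obj
      ((Plus.singleFunctor A 0).obj S.X₁))⟦(1 : ℤ)⟧) (-1) 0)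

lemma acyclic_biprod (X Y : A) (hX : F.acyclic X) (hY : F.acyclic Y) : F.acyclic (X ⊞ Y) :=
  acyclic_X₂ (ShortComplex.Splitting.ofHasBinaryBiproduct X Y).shortExact hX hY

end

variable [PreservesFiniteLimits F]

/-- The comparison between `F` and its right derived functor is an isomorphism in degree `0`. -/
instance isIso_homologyFunctor_map_singleToRightDerivedFunctorPlus (X : A) :
    IsIso ((Plus.homologyFunctor B 0).map (F.singleToRightDerivedFunctorPlus.app X)) := by
  let K := (CochainComplex.Plus.single A).obj X
  have hK : K.obj.IsStrictlyGE 0 :=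
    inferInstanceAs (((CochainComplex.singleFunctor A 0).obj X).IsStrictlyGE 0)
  obtain ⟨J, hJ, i, hi⟩ := CochainComplex.Plus.exists_quasiIso_injective K 0
  let L := (InjectiveObject.ι A).mapCochainComplexPlus.obj J
  have hL : CochainComplex.IsStrictlyGE L.obj 0 :=
    inferInstanceAs (CochainComplex.IsStrictlyGE
      (((InjectiveObject.ι A).mapHomologicalComplex (.up ℤ)).obj J.obj) 0)
  have : IsIso (Plus.Q.map i) := (Plus.isIso_Q_map_iff i).2 hi
  have hi' : QuasiIso i.hom := hi
  have nat := F.toRightDerivedFunctorPlus.naturality i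
  have h₁ : QuasiIsoAt ((F.mapCochainComplexPlus.map i).hom) 0 := by
    refine quasiIsoAt_mapHomologicalComplex_map (F := F) i.hom (-1) 0 1 (by lia) (by lia)
      ?_ ?_ ?_ inferInstance
    · exact (K.obj.isZero_of_isStrictlyGE 0 (-1)).eq_of_src _ _
    · exact (HomologicalComplex.isZero_single_obj_X (.up ℤ) 0 X 1 (by lia)).eq_of_tgt _ _
    · exact (CochainComplex.isZero_of_isStrictlyGE L.obj 0 (-1)).eq_of_src _ _
  have h₂ : IsIso ((Plus.homologyFunctor B 0).map
      (Plus.Q.map (F.mapCochainComplexPlus.map i))) := by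
    rw [quasiIsoAt_iff_isIso_homologyMap] at h₁
    exact (NatIso.isIso_map_iff (Plus.homologyFunctorFactors 0)
      (F.mapCochainComplexPlus.map i)).2 h₁
  have h₃ : IsIso ((Plus.homologyFunctor B 0).map (F.toRightDerivedFunctorPlus.app K)) := by
    have := congr_arg (Plus.homologyFunctor B 0).map nat
    dsimp at this
    rw [Functor.map_comp, Functor.map_comp] at this
    exact IsIso.of_isIso_fac_right this.symm
  have h₄ : IsIso ((Plus.homologyFunctor B 0).map
      (Plus.Q.map (F.singleMapCochainComplexPlusIso.hom.app X) ≫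
        F.toRightDerivedFunctorPlus.app K)) := by
    rw [Functor.map_comp]
    infer_instance
  exact h₄

/-- The comparison between `F` and its right derived functor is an isomorphism on acyclic
objects. -/
instance isIso_singleToRightDerivedFunctorPlus_app (X : F.acyclic.FullSubcategory) :
    IsIso (F.singleToRightDerivedFunctorPlus.app X.obj) := by
  obtain ⟨X, hX⟩ := X
  rw [Plus.isIso_iff]
  intro n
  have h₁ : (F.rightDerivedFunctorPlus.obj ((Plus.singleFunctor A 0).obj X)).IsGE 0 :=
    F.isGE_rightDerivedFunctorPlus_obj _ 0 inferInstance
  have h₂ : (F.rightDerivedFunctorPlus.obj ((Plus.singleFunctor A 0).obj X)).IsLE 0 := hX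
  obtain hn | rfl | hn := lt_trichotomy n 0
  · exact (Plus.isZero_homology_of_isGE ((Plus.singleFunctor B 0).obj (F.obj X)) 0 n hn).isIso
      (Plus.isZero_homology_of_isGE
        (F.rightDerivedFunctorPlus.obj ((Plus.singleFunctor A 0).obj X)) 0 n hn) _
  · infer_instance
  · exact (Plus.isZero_homology_of_isLE ((Plus.singleFunctor B 0).obj (F.obj X)) 0 n hn).isIso
      (Plus.isZero_homology_of_isLE
        (F.rightDerivedFunctorPlus.obj ((Plus.singleFunctor A 0).obj X)) 0 n hn) _

/-- On acyclic objects, the right derived functor of `F` is given by `F`. -/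
noncomputable def acyclicIso :
    F.acyclic.ι ⋙ F ⋙ Plus.singleFunctor B 0 ≅
      F.acyclic.ι ⋙ Plus.singleFunctor A 0 ⋙ F.rightDerivedFunctorPlus :=
  NatIso.ofComponents (fun X ↦ asIso (F.singleToRightDerivedFunctorPlus.app X.obj))
    (fun f ↦ F.singleToRightDerivedFunctorPlus.naturality f.hom)

/-- A left exact functor is the zeroth right derived functor of itself. -/
noncomputable def isoRightDerivedZero :
    F ≅ Plus.singleFunctor A 0 ⋙ F.rightDerivedFunctorPlus ⋙ Plus.homologyFunctor B 0 :=
  (isoWhiskerLeft F Plus.singleFunctorCompHomologyFunctorIso).symm ≪≫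
    (NatIso.ofComponents (fun X ↦ asIso ((Plus.homologyFunctor B 0).map
      (F.singleToRightDerivedFunctorPlus.app X))) (fun {X Y} f ↦ by
        have := congr_arg (Plus.homologyFunctor B 0).map
          (F.singleToRightDerivedFunctorPlus.naturality f)
        rw [Functor.map_comp, Functor.map_comp] at this
        exact this) : F ⋙ Plus.singleFunctor B 0 ⋙ Plus.homologyFunctor B 0 ≅
        Plus.singleFunctor A 0 ⋙ F.rightDerivedFunctorPlus ⋙ Plus.homologyFunctor B 0)

variable {F}

/-- As `F` is its own zeroth right derived functor, it can be tested in the derived category whether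
`F` sends a morphism to an epimorphism. -/
lemma epi_map_iff {X Y : A} (f : X ⟶ Y) :
    Epi (F.map f) ↔ Epi ((Plus.homologyFunctor B 0).map
      (F.rightDerivedFunctorPlus.map ((Plus.singleFunctor A 0).map f))) :=
  (MorphismProperty.epimorphisms B).arrow_mk_iso_iff
    (((Functor.mapArrowFunctor _ _).mapIso F.isoRightDerivedZero).app (Arrow.mk f))

lemma shortExact_map_of_acyclic {S : ShortComplex A} (hS : S.ShortExact) (h₁ : F.acyclic S.X₁) :
    (S.map F).ShortExact := by
  have := hS.mono_f
  have := hS.epi_g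
  have : Epi (F.map S.g) := by
    obtain ⟨h, hT⟩ := Plus.exists_distTriang_of_shortExact hS
    have : Plus.TStructure.t.IsLE _ 0 := h₁
    have := Plus.TStructure.t.isLE_shift
      (F.rightDerivedFunctorPlus.obj ((Plus.singleFunctor A 0).obj S.X₁)) 0 1 (-1)
    have hE : Epi ((Plus.homologyFunctor B 0).map
        (F.rightDerivedFunctorPlus.map ((Plus.singleFunctor A 0).map S.g))) :=
      (Plus.exact_homology (rot_of_distTriang _
        (F.rightDerivedFunctorPlus.map_distinguished _ hT)) 0).epi_f
        ((Plus.isZero_homology_of_isLE ((F.rightDerivedFunctorPlus.obj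
          ((Plus.singleFunctor A 0).obj S.X₁))⟦(1 : ℤ)⟧) (-1) 0 (by lia)).eq_of_tgt _ _)
    exact (epi_map_iff _).2 hE
  exact
    { exact := hS.exact.map_of_mono_of_preservesKernel F inferInstance inferInstance
      mono_f := inferInstanceAs (Mono (F.map S.f))
      epi_g := this }

end CategoryTheory.Functor

/-! ### Complexes of acyclic objects -/

namespace CochainComplex

variable {C : Type*} [Category* C] [Abelian C]

lemma quasiIso_iff_acyclic_mappingCone {K L : CochainComplex C ℤ} (f : K ⟶ L) :
    QuasiIso f ↔ (mappingCone f).Acyclic := by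
  rw [← HomotopyCategory.quotient_obj_mem_subcategoryAcyclic_iff_acyclic,
    ← HomologicalComplex.mem_quasiIso_iff, ← HomotopyCategory.quotient_map_mem_quasiIso_iff,
    HomotopyCategory.quasiIso_eq_trW_subcategoryAcyclic]
  exact ObjectProperty.trW_iff_of_distinguished _ _
    (HomotopyCategory.mappingCone_triangleh_distinguished f)

lemma epi_toCycles (K : CochainComplex C ℤ) (i j : ℤ) (hij : i + 1 = j)
    (h : K.ExactAt j) : Epi (K.toCycles i j) :=
  Preadditive.epi_of_isZero_cokernel' _ (K.homologyIsCokernel i j (by simp; lia))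
    h.isZero_homology

/-- If a complex is exact in degree `i + 1`, its cycles in degrees `i` and `i + 1` form a short
exact sequence with its term in degree `i`. -/
lemma shortExact_cycles (K : CochainComplex C ℤ) (i j : ℤ) (hij : i + 1 = j)
    (h : K.ExactAt j) :
    (ShortComplex.mk (K.iCycles i) (K.toCycles i j) (by
      rw [← cancel_mono (K.iCycles j), Category.assoc, HomologicalComplex.toCycles_i,
        HomologicalComplex.iCycles_d, zero_comp])).ShortExact := by
  have hE : Epi (K.toCycles i j) := K.epi_toCycles i j hij h
  let S := ShortComplex.mk (K.iCycles i) (K.d i j) (by simp)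
  have hS : S.Exact :=
    ShortComplex.exact_of_f_is_kernel S (K.cyclesIsKernel i j (by simp; lia))
  let φ : ShortComplex.mk (K.iCycles i) (K.toCycles i j) (by
      rw [← cancel_mono (K.iCycles j), Category.assoc, HomologicalComplex.toCycles_i,
        HomologicalComplex.iCycles_d, zero_comp]) ⟶ S :=
    { τ₁ := 𝟙 _, τ₂ := 𝟙 _, τ₃ := K.iCycles j
      comm₁₂ := by simp [S]
      comm₂₃ := by simp [S] }
  have : Epi φ.τ₁ := inferInstanceAs (Epi (𝟙 _))
  have : IsIso φ.τ₂ := inferInstanceAs (IsIso (𝟙 _))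
  have : Mono φ.τ₃ := inferInstanceAs (Mono (K.iCycles j))
  exact
    { exact := (ShortComplex.exact_iff_of_epi_of_isIso_of_mono φ).2 hS
      mono_f := inferInstanceAs (Mono (K.iCycles i))
      epi_g := hE }

end CochainComplex

namespace CategoryTheory.Functor

variable {A B : Type*} [Category* A] [Category* B] [Abelian A] [Abelian B]
  [HasDerivedCategory A] [HasDerivedCategory B]
variable [EnoughInjectives A] {F : A ⥤ B} [F.Additive]

/-- The cycles of a bounded below exact complex of acyclic objects are acyclic: by induction on the
degree, they are quotients of an acyclic object by an acyclic object. -/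
lemma acyclic_cycles {K : CochainComplex A ℤ} (n : ℤ) [K.IsStrictlyGE n]
    (h : ∀ i, F.acyclic (K.X i)) (hK : K.Acyclic) (j : ℤ) : F.acyclic (K.cycles j) := by
  by_cases hj : j < n
  · exact acyclic_of_isZero _ ((K.isZero_of_isStrictlyGE n j hj).of_mono (K.iCycles j))
  · obtain ⟨k, rfl⟩ := Int.le.dest (not_lt.1 hj)
    induction k with
    | zero =>
      exact acyclic_X₃ (K.shortExact_cycles (n - 1) _ (by simp) (hK _))
        (acyclic_of_isZero _ ((K.isZero_of_isStrictlyGE n (n - 1) (by lia)).of_mono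
          (K.iCycles (n - 1)))) (h _)
    | succ k hk =>
      exact acyclic_X₃ (K.shortExact_cycles (n + k) _ (by simp; lia) (hK _)) (hk (by lia)) (h _)

variable [PreservesFiniteLimits F]

lemma acyclic_mapHomologicalComplex_obj {K : CochainComplex A ℤ} (n : ℤ) [K.IsStrictlyGE n]
    (h : ∀ i, F.acyclic (K.X i)) (hK : K.Acyclic) :
    ((F.mapHomologicalComplex (.up ℤ)).obj K).Acyclic := by
  intro j
  rw [HomologicalComplex.exactAt_iff' _ (j - 1) j (j + 1) (by simp) (by simp)]
  let S := ShortComplex.mk (K.iCycles j) (K.d j (j + 1)) (by simp)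
  have hS : (S.map F).Exact :=
    (ShortComplex.exact_of_f_is_kernel S
      (K.cyclesIsKernel j (j + 1) (by simp))).map_of_mono_of_preservesKernel F
      (inferInstanceAs (Mono (K.iCycles j))) inferInstance
  let φ : ((F.mapHomologicalComplex (.up ℤ)).obj K).sc' (j - 1) j (j + 1) ⟶ S.map F :=
    { τ₁ := F.map (K.toCycles (j - 1) j), τ₂ := 𝟙 (F.obj (K.X j)), τ₃ := 𝟙 (F.obj (K.X (j + 1)))
      comm₁₂ := (F.map_comp _ _).symm.trans
        ((congr_arg F.map (K.toCycles_i _ _)).trans (Category.comp_id _).symm)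
      comm₂₃ := (Category.id_comp _).trans (Category.comp_id _).symm }
  have : Epi φ.τ₁ := (shortExact_map_of_acyclic
    (K.shortExact_cycles (j - 1) j (by simp) (hK _)) (acyclic_cycles n h hK (j - 1))).epi_g
  have : IsIso φ.τ₂ := inferInstanceAs (IsIso (𝟙 _))
  have : Mono φ.τ₃ := inferInstanceAs (Mono (𝟙 _))
  exact (ShortComplex.exact_iff_of_epi_of_isIso_of_mono φ).2 hS

/-- A left exact functor preserves quasi-isomorphisms between bounded below complexes of acyclic
objects, because it preserves the exactness of their mapping cones. -/
lemma quasiIso_mapHomologicalComplex_map {K L : CochainComplex A ℤ} (f : K ⟶ L) (n : ℤ)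
    [K.IsStrictlyGE (n + 1)] [L.IsStrictlyGE n] (hK : ∀ i, F.acyclic (K.X i))
    (hL : ∀ i, F.acyclic (L.X i)) (hf : QuasiIso f) :
    QuasiIso ((F.mapHomologicalComplex (.up ℤ)).map f) := by
  rw [CochainComplex.quasiIso_iff_acyclic_mappingCone] at hf ⊢
  have := CochainComplex.isStrictlyGE_mappingCone f (n + 1) n n
  refine fun j ↦ HomologicalComplex.ExactAt.of_iso
    (acyclic_mapHomologicalComplex_obj n (fun i ↦ ?_) hf j)
    (CochainComplex.mappingCone.mapHomologicalComplexIso f F)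
  exact F.acyclic.prop_of_iso (HomologicalComplex.homotopyCofiber.XIsoBiprod f i (i + 1) rfl).symm
    (acyclic_biprod _ _ (hK _) (hL _))

/-- The right derived functor can be computed by using complexes of acyclic objects. -/
lemma isIso_toRightDerivedFunctorPlus_app (K : CochainComplex.Plus A)
    (hK : ∀ i, F.acyclic (K.obj.X i)) : IsIso (F.toRightDerivedFunctorPlus.app K) := by
  obtain ⟨n, hn⟩ := K.property
  obtain ⟨J, hJ, i, hi⟩ := CochainComplex.Plus.exists_quasiIso_injective K n
  let L := (InjectiveObject.ι A).mapCochainComplexPlus.obj J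
  have hL : CochainComplex.IsStrictlyGE L.obj n :=
    inferInstanceAs (CochainComplex.IsStrictlyGE
      (((InjectiveObject.ι A).mapHomologicalComplex (.up ℤ)).obj J.obj) n)
  have := L.obj.isStrictlyGE_of_ge (n - 1) n (by lia)
  have := K.obj.isStrictlyGE_of_ge (n - 1 + 1) n (by lia)
  have : IsIso (Plus.Q.map i) := (Plus.isIso_Q_map_iff i).2 hi
  have : IsIso (Plus.Q.map (F.mapCochainComplexPlus.map i)) := by
    rw [Plus.isIso_Q_map_iff]
    exact quasiIso_mapHomologicalComplex_map (F := F) i.hom (n - 1) hK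
      (fun j ↦ by
        have : Injective (J.obj.X j).obj := (J.obj.X j).property
        exact acyclic_of_injective (F := F) (J.obj.X j).obj) hi
  have nat := F.toRightDerivedFunctorPlus.naturality i
  dsimp at nat
  exact IsIso.of_isIso_fac_right nat.symm

end CategoryTheory.Functor

/-! ### Left resolutions of complexes -/

namespace CochainComplex

variable {C : Type*} [Category* C] [Abelian C]

lemma quasiIso_mappingCone_map [HasDerivedCategory C] {K₁ L₁ K₂ L₂ : CochainComplex C ℤ}
    (f₁ : K₁ ⟶ L₁) (f₂ : K₂ ⟶ L₂) (a : K₁ ⟶ K₂) (b : L₁ ⟶ L₂) (comm : f₁ ≫ b = a ≫ f₂)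
    [QuasiIso a] [QuasiIso b] : QuasiIso (mappingCone.map f₁ f₂ a b comm) := by
  rw [← isIso_Q_map_iff_quasiIso]
  exact isIso₃_of_isIso₁₂
    (DerivedCategory.Q.mapTriangle.map (mappingCone.triangleMap f₁ f₂ a b comm))
    (mappingCone_triangle_distinguished f₁) (mappingCone_triangle_distinguished f₂)
    (inferInstanceAs (IsIso (DerivedCategory.Q.map a)))
    (inferInstanceAs (IsIso (DerivedCategory.Q.map b)))

lemma isStrictlyLE_mappingCone {K L : CochainComplex C ℤ} (f : K ⟶ L)
    (n : ℤ) [K.IsStrictlyLE n] [L.IsStrictlyLE n] : (mappingCone f).IsStrictlyLE n := by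
  rw [isStrictlyLE_iff]
  intro i hi
  rw [mappingCone.isZero_X_iff]
  exact ⟨K.isZero_of_isStrictlyLE n _ (by lia), L.isZero_of_isStrictlyLE n _⟩

open HomComplex in
/-- If every term of a complex `Y` is covered by an object in a class `E` which is stable by direct
sums, there is a degreewise epimorphism to `Y` from a complex with terms in `E`: take the
cone of the identity of a complex with zero differentials. -/
lemma exists_epi_of_objectProperty (E : ObjectProperty C) [E.IsClosedUnderIsomorphisms]
    (hE : ∀ X Y, E X → E Y → E (X ⊞ Y)) (Y : CochainComplex C ℤ)
    (hY : ∀ n, ∃ (P : C) (π : P ⟶ Y.X n), E P ∧ Epi π ∧ (IsZero (Y.X n) → IsZero P))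
    (a : ℤ) [Y.IsStrictlyGE a] :
    ∃ (M : CochainComplex C ℤ) (π : M ⟶ Y), (∀ n, E (M.X n)) ∧ (∀ n, Epi (π.f n)) ∧
      M.IsStrictlyGE (a - 1) ∧ ∀ b, Y.IsStrictlyLE b → M.IsStrictlyLE (b + 1) := by
  choose P π hP hπ h₀ using hY
  let M : CochainComplex C ℤ :=
    { X n := P (n - 1)
      d _ _ := 0 }
  let α : Cochain M Y (-1) := Cochain.mk (fun p q hpq ↦
    (eqToHom (by obtain rfl : q = p - 1 := by lia
                 rfl) : M.X p ⟶ P q) ≫ π q)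
  let β : M ⟶ Y := Cocycle.homOf (Cocycle.mk (δ (-1) 0 α) 1 (by lia) (δ_δ (-1) 0 1 α))
  have hβ : δ (-1) 0 α = Cochain.ofHom (𝟙 M ≫ β) := by simp [β]
  let φ := mappingCone.desc (𝟙 M) α β hβ
  have hM (n : ℤ) : Epi (φ.f n) := by
    have : Epi (α.v (n + 1) n (by lia)) := by
      dsimp [α]
      infer_instance
    exact epi_of_epi_fac (mappingCone.inl_v_desc_f (𝟙 M) α β hβ (n + 1) n _)
  have hGE : M.IsStrictlyGE a := by
    rw [isStrictlyGE_iff]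
    intro i hi
    exact h₀ _ (Y.isZero_of_isStrictlyGE a _ (by lia))
  refine ⟨mappingCone (𝟙 M), φ, fun n ↦ ?_, hM, ?_, fun b hb ↦ ?_⟩
  · exact E.prop_of_iso (HomologicalComplex.homotopyCofiber.XIsoBiprod (𝟙 M) n (n + 1) rfl).symm
      (hE _ _ (hP _) (hP _))
  · exact isStrictlyGE_mappingCone _ a a _
  · have : M.IsStrictlyLE (b + 1) := by
      rw [isStrictlyLE_iff]
      intro i hi
      exact h₀ _ (Y.isZero_of_isStrictlyLE b _ (by lia))
    exact isStrictlyLE_mappingCone _ _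

/-- Let `E` be a class of objects, and `D k` classes of objects admitting
left resolutions of length `k` by objects in `E` (this is expressed by saying that the
objects in `D (k + 1)` are covered by objects in `E`, and the kernel of any such cover belongs
to `D k`). Then, a bounded below complex with terms in `D k` receives a quasi-isomorphism from
a bounded below complex with terms in `E`. -/
lemma exists_quasiIso_of_objectProperty (E : ObjectProperty C) [E.IsClosedUnderIsomorphisms]
    (hE : ∀ X Y, E X → E Y → E (X ⊞ Y)) (D : ℕ → ObjectProperty C) (h₀ : D 0 ≤ E)
    (hcov : ∀ k X, D (k + 1) X → ∃ (P : C) (π : P ⟶ X), E P ∧ Epi π ∧ (IsZero X → IsZero P))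
    (hker : ∀ k (S : ShortComplex C), S.ShortExact → E S.X₂ → D (k + 1) S.X₃ → D k S.X₁)
    (k : ℕ) (Y : CochainComplex C ℤ) (hY : ∀ n, D k (Y.X n)) (a : ℤ) [Y.IsStrictlyGE a] :
    ∃ (L : CochainComplex C ℤ) (f : L ⟶ Y), QuasiIso f ∧ (∀ n, E (L.X n)) ∧
      (∃ a', L.IsStrictlyGE a') ∧ ∀ b, Y.IsStrictlyLE b → ∃ b', L.IsStrictlyLE b' := by
  have : HasDerivedCategory C := MorphismProperty.HasLocalization.standard _
  induction k generalizing Y a with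
  | zero => exact ⟨Y, 𝟙 Y, inferInstance, fun n ↦ h₀ _ (hY n), ⟨a, inferInstance⟩,
      fun b hb ↦ ⟨b, hb⟩⟩
  | succ k hk =>
    obtain ⟨M, π, hM, hπ, hGE, hLE⟩ :=
      exists_epi_of_objectProperty E hE Y (fun n ↦ hcov k _ (hY n)) a
    let S := ShortComplex.mk (kernel.ι π) π (by simp)
    have : Epi π := HomologicalComplex.epi_of_epi_f _ hπ
    have hS : S.ShortExact :=
      { exact := ShortComplex.exact_of_f_is_kernel _ (kernelIsKernel π) }
    have hS' (n : ℤ) := hS.map_of_exact (HomologicalComplex.eval C (.up ℤ) n)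
    have : (kernel π).IsStrictlyGE (a - 1) := by
      rw [isStrictlyGE_iff]
      intro i hi
      have := (hS' i).mono_f
      exact (M.isZero_of_isStrictlyGE (a - 1) i).of_mono ((kernel.ι π).f i)
    obtain ⟨L, f, hf, hL, ⟨a', _⟩, hL'⟩ := hk (kernel π) (fun n ↦ hker k _ (hS' n) (hM n) (hY n))
      (a - 1)
    have : QuasiIso f := hf
    have := mappingCone.quasiIso_descShortComplex hS
    have : QuasiIso (mappingCone.map (f ≫ kernel.ι π) (kernel.ι π) f (𝟙 _) (by simp)) :=
      quasiIso_mappingCone_map ..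
    refine ⟨mappingCone (f ≫ kernel.ι π),
      mappingCone.map (f ≫ kernel.ι π) (kernel.ι π) f (𝟙 _) (by simp) ≫
        mappingCone.descShortComplex S, ?_, fun n ↦ ?_, ?_, fun b hb ↦ ?_⟩
    · exact quasiIso_comp _ _
    · exact E.prop_of_iso
        (HomologicalComplex.homotopyCofiber.XIsoBiprod (f ≫ kernel.ι π) n (n + 1) rfl).symm
        (hE _ _ (hL _) (hM _))
    · exact ⟨min (a' - 1) (a - 1), isStrictlyGE_mappingCone _ a' (a - 1) _⟩
    · have := hLE b hb
      have : (kernel π).IsStrictlyLE (b + 1) := by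
        rw [isStrictlyLE_iff]
        intro i hi
        have := (hS' i).mono_f
        exact (M.isZero_of_isStrictlyLE (b + 1) i).of_mono ((kernel.ι π).f i)
      obtain ⟨b', _⟩ := hL' (b + 1) this
      have := L.isStrictlyLE_of_le b' (max b' (b + 1)) (by simp)
      have := M.isStrictlyLE_of_le (b + 1) (max b' (b + 1)) (by simp)
      exact ⟨max b' (b + 1), isStrictlyLE_mappingCone _ _⟩

end CochainComplex

/-! ### Derived equivalences and amplitude -/

namespace CategoryTheory.Functor

/-- A functor `G : C ⥤ D` restricts to an equivalence between the full subcategories of `C` and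
`D` given by `P` and `P'`. -/
structure RestrictsToEquivalence {C D : Type*} [Category* C] [Category* D] (G : C ⥤ D)
    (P : ObjectProperty C) (P' : ObjectProperty D) : Prop where
  prop_obj (X : C) (hX : P X) : P' (G.obj X)
  map_bijective (X Y : C) (hX : P X) (hY : P Y) : Function.Bijective (G.map : (X ⟶ Y) → _)
  exists_iso (Y : D) (hY : P' Y) : ∃ X, P X ∧ Nonempty (G.obj X ≅ Y)

section

variable {C D : Type*} [Category* C] [Category* D] {G : C ⥤ D}
  {P : ObjectProperty C} {P' : ObjectProperty D}

lemma RestrictsToEquivalence.isEquivalence (h : G.RestrictsToEquivalence P P')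
    (h' : ∀ X, P X → P' (G.obj X)) :
    (P'.lift (P.ι ⋙ G) (fun X ↦ h' X.obj X.property)).IsEquivalence where
  faithful := ⟨fun {X Y f g} hfg ↦ by
    ext
    exact (h.map_bijective _ _ X.property Y.property).1 ((P'.ι).congr_map hfg)⟩
  full := ⟨fun {X Y} f ↦ by
    obtain ⟨g, hg⟩ := (h.map_bijective _ _ X.property Y.property).2 f.hom
    exact ⟨ObjectProperty.homMk g, by ext; exact hg⟩⟩
  essSurj := ⟨fun Y ↦ by
    obtain ⟨X, hX, ⟨e⟩⟩ := h.exists_iso Y.obj Y.property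
    exact ⟨⟨X, hX⟩, ⟨P'.ι.preimageIso e⟩⟩⟩

lemma RestrictsToEquivalence.of_isEquivalence (h' : ∀ X, P X → P' (G.obj X))
    (h : (P'.lift (P.ι ⋙ G) (fun X ↦ h' X.obj X.property)).IsEquivalence) :
    G.RestrictsToEquivalence P P' where
  prop_obj := h'
  map_bijective X Y hX hY := by
    let H := P'.lift (P.ι ⋙ G) (fun X ↦ h' X.obj X.property)
    refine ⟨fun f g hfg ↦ ?_, fun f ↦ ?_⟩
    · have : H.map (X := ⟨X, hX⟩) (Y := ⟨Y, hY⟩) (ObjectProperty.homMk f) =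
        H.map (X := ⟨X, hX⟩) (Y := ⟨Y, hY⟩) (ObjectProperty.homMk g) := by ext; exact hfg
      exact P.ι.congr_map (H.map_injective this)
    · obtain ⟨g, hg⟩ := H.map_surjective (X := ⟨X, hX⟩) (Y := ⟨Y, hY⟩)
        (ObjectProperty.homMk (X := H.obj ⟨X, hX⟩) (Y := H.obj ⟨Y, hY⟩) f)
      exact ⟨g.hom, P'.ι.congr_map hg⟩
  exists_iso Y hY := by
    let H := P'.lift (P.ι ⋙ G) (fun X ↦ h' X.obj X.property)
    exact ⟨(H.objPreimage ⟨Y, hY⟩).obj, (H.objPreimage ⟨Y, hY⟩).property,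
      ⟨P'.ι.mapIso (H.objObjPreimageIso ⟨Y, hY⟩)⟩⟩

end

end CategoryTheory.Functor

namespace DerivedCategory.Plus

/-- If the proposition `p` holds, these are the objects of `D⁺(C)` with bounded cohomology,
and all the objects of `D⁺(C)` otherwise. -/
def boundedIf (p : Prop) (C : Type*) [Category* C] [Abelian C] [HasDerivedCategory C] :
    ObjectProperty (DerivedCategory.Plus C) :=
  fun X ↦ p → bounded C X

variable {p : Prop} {C : Type*} [Category* C] [Abelian C] [HasDerivedCategory C]

lemma boundedIf_of_isLE (X : DerivedCategory.Plus C) (n : ℤ) (hX : X.IsLE n) :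
    boundedIf p C X := fun _ ↦ ⟨n, hX⟩

lemma boundedIf_single (X : C) (n : ℤ) : boundedIf p C ((singleFunctor C n).obj X) :=
  boundedIf_of_isLE _ n inferInstance

instance : (boundedIf p C).IsClosedUnderIsomorphisms where
  of_iso e hX hp := by
    obtain ⟨n, hn : Plus.IsLE _ n⟩ := hX hp
    exact ⟨n, TStructure.t.isLE_of_iso e n⟩

lemma boundedIf_shift (X : DerivedCategory.Plus C) (hX : boundedIf p C X) (a : ℤ) :
    boundedIf p C (X⟦a⟧) := by
  intro hp
  obtain ⟨n, hn : Plus.IsLE _ n⟩ := hX hp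
  exact ⟨n - a, TStructure.t.isLE_shift X n a (n - a)⟩

lemma exists_isGE (X : DerivedCategory.Plus C) : ∃ n : ℤ, X.IsGE n := by
  obtain ⟨n, hn⟩ := X.property
  exact ⟨n, (isGE_ι_obj_iff X n).1 hn⟩

lemma boundedIf_truncGE (X : DerivedCategory.Plus C) (hX : boundedIf p C X) (n : ℤ) :
    boundedIf p C ((TStructure.t.truncGE n).obj X) := by
  intro hp
  obtain ⟨m, hm : Plus.IsLE _ m⟩ := hX hp
  exact ⟨m, inferInstance⟩

variable {D : Type*} [Category* D] [Abelian D] [HasDerivedCategory D]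
  (G : DerivedCategory.Plus C ⥤ DerivedCategory.Plus D)

lemma restrictsToEquivalence_boundedIf_true_iff :
    G.RestrictsToEquivalence (boundedIf True C) (boundedIf True D) ↔
      G.InducesBoundedEquivalence := by
  have hC : boundedIf True C = bounded C := by ext; simp [boundedIf]
  have hD : boundedIf True D = bounded D := by ext; simp [boundedIf]
  rw [hC, hD]
  exact ⟨fun h ↦ ⟨h.prop_obj, h.isEquivalence h.prop_obj⟩,
    fun ⟨h, h'⟩ ↦ Functor.RestrictsToEquivalence.of_isEquivalence h h'⟩

lemma restrictsToEquivalence_boundedIf_false_iff :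
    G.RestrictsToEquivalence (boundedIf False C) (boundedIf False D) ↔ G.IsEquivalence := by
  have hC X : boundedIf False C X := False.elim
  have hD X : boundedIf False D X := False.elim
  exact ⟨fun h ↦
    { faithful := ⟨fun hfg ↦ (h.map_bijective _ _ (hC _) (hC _)).1 hfg⟩
      full := ⟨fun f ↦ (h.map_bijective _ _ (hC _) (hC _)).2 f⟩
      essSurj := ⟨fun Y ↦ (h.exists_iso Y (hD _)).imp (fun _ h ↦ h.2)⟩ },
    fun h ↦
    { prop_obj := fun _ _ ↦ hD _
      map_bijective := fun _ _ _ _ ↦ ⟨fun _ _ h ↦ G.map_injective h, G.map_surjective⟩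
      exists_iso := fun Y _ ↦ ⟨G.objPreimage Y, hC _, ⟨G.objObjPreimageIso Y⟩⟩ }⟩

end DerivedCategory.Plus

namespace CategoryTheory.Functor

variable {A B : Type*} [Category* A] [Category* B] [Abelian A] [Abelian B]
  [HasDerivedCategory A] [HasDerivedCategory B]
variable [EnoughInjectives A] {F : A ⥤ B} [F.Additive] {p : Prop}

/-- The condition that the right derived functor of `F` is an equivalence on bounded
below derived categories, or that it induces an equivalence on bounded derived categories (when
the proposition `p` holds). -/
abbrev IsDerivedEquivalence (F : A ⥤ B) [F.Additive] (p : Prop) : Prop :=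
  F.rightDerivedFunctorPlus.RestrictsToEquivalence (Plus.boundedIf p A) (Plus.boundedIf p B)

namespace IsDerivedEquivalence

/-- An object is in degrees `≤ n` when its image by the right derived functor is. -/
lemma isLE_of_isLE (h : F.IsDerivedEquivalence p)
    (X : DerivedCategory.Plus A) (hX : Plus.boundedIf p A X) (n : ℤ)
    (hX' : (F.rightDerivedFunctorPlus.obj X).IsLE n) : X.IsLE n := by
  change Plus.TStructure.t.IsLE X n
  rw [Plus.TStructure.t.isLE_iff_orthogonal n (n + 1) rfl]
  intro Y f hY
  have hT : ((Plus.TStructure.t.truncGE (n + 1)).obj X).IsGE (n + 1) := inferInstance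
  have hT' := F.isGE_rightDerivedFunctorPlus_obj _ _ hT
  have : (Plus.TStructure.t.truncGEπ (n + 1)).app X = 0 := by
    apply (h.map_bijective _ _ hX (Plus.boundedIf_truncGE X hX (n + 1))).1
    rw [Functor.map_zero]
    exact Plus.TStructure.t.zero_of_isLE_of_isGE _ n (n + 1) (by lia) hX' hT'
  rw [← Plus.TStructure.t.π_descTruncGE f (n + 1), this, zero_comp]

variable (p F) in
/-- The objects which are isomorphic in the derived category to the image by the right derived
functor of an object in degrees `≥ -k`. -/
def amplitude (k : ℤ) : ObjectProperty B :=
  fun X ↦ ∃ J, Plus.boundedIf p A J ∧ J.IsGE (-k) ∧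
    Nonempty (F.rightDerivedFunctorPlus.obj J ≅ (Plus.singleFunctor B 0).obj X)

lemma amplitude_monotone {k l : ℤ} (hkl : k ≤ l) : amplitude F p k ≤ amplitude F p l := by
  rintro X ⟨J, hJ, h, e⟩
  exact ⟨J, hJ, Plus.TStructure.t.isGE_of_ge J (-l) (-k), e⟩

lemma exists_amplitude (h : F.IsDerivedEquivalence p) (X : B) : ∃ k : ℕ, amplitude F p k X := by
  obtain ⟨J, hJ, e⟩ := h.exists_iso _ (Plus.boundedIf_single X 0)
  obtain ⟨n, hn⟩ := J.exists_isGE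
  exact ⟨(-n).toNat, J, hJ, Plus.TStructure.t.isGE_of_ge J _ n, e⟩

variable [PreservesFiniteLimits F]

/-- As the right derived functor coincides with `F` on acyclic objects, `F` is fully faithful on
acyclic objects. -/
lemma map_acyclic_bijective (h : F.IsDerivedEquivalence p)
    (X Y : A) (hX : F.acyclic X) (hY : F.acyclic Y) :
    Function.Bijective (F.map : (X ⟶ Y) → _) := by
  have h₁ := h.map_bijective _ _ (Plus.boundedIf_single X 0) (Plus.boundedIf_single Y 0)
  have : IsIso (F.singleToRightDerivedFunctorPlus.app X) :=
    F.isIso_singleToRightDerivedFunctorPlus_app ⟨X, hX⟩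
  have : IsIso (F.singleToRightDerivedFunctorPlus.app Y) :=
    F.isIso_singleToRightDerivedFunctorPlus_app ⟨Y, hY⟩
  have nat (f : X ⟶ Y) := F.singleToRightDerivedFunctorPlus.naturality f
  dsimp at nat
  refine ⟨fun f g hfg ↦ ?_, fun f ↦ ?_⟩
  · apply (Plus.singleFunctor A 0).map_injective
    apply h₁.1
    rw [← cancel_epi (F.singleToRightDerivedFunctorPlus.app X)]
    exact (nat f).symm.trans ((congr_arg (fun t ↦ (Plus.singleFunctor B 0).map t ≫
      F.singleToRightDerivedFunctorPlus.app Y) hfg).trans (nat g))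
  · obtain ⟨g, hg⟩ := h₁.2 (CategoryTheory.inv (F.singleToRightDerivedFunctorPlus.app X) ≫
      (Plus.singleFunctor B 0).map f ≫ F.singleToRightDerivedFunctorPlus.app Y)
    obtain ⟨g, rfl⟩ := (Plus.singleFunctor A 0).map_surjective g
    refine ⟨g, (Plus.singleFunctor B 0).map_injective ?_⟩
    rw [← cancel_mono (F.singleToRightDerivedFunctorPlus.app Y)]
    rw [IsIso.eq_inv_comp] at hg
    exact (nat g).trans hg

/-- The objects of amplitude `0` are the images by `F` of acyclic objects: if `J` is in degrees
`≥ 0` and corresponds to an object of `B`, then it is also in degrees `≤ 0`, i.e. it is an object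
of `A`. -/
lemma exists_iso_of_amplitude_zero (h : F.IsDerivedEquivalence p) (X : B)
    (hX : amplitude F p 0 X) : ∃ Y, F.acyclic Y ∧ Nonempty (F.obj Y ≅ X) := by
  obtain ⟨J, hJ, hJ', ⟨e⟩⟩ := hX
  have h₁ : (F.rightDerivedFunctorPlus.obj J).IsLE 0 := Plus.TStructure.t.isLE_of_iso e.symm 0
  obtain ⟨Y, ⟨e'⟩⟩ := J.exists_iso_singleFunctor_obj hJ' (h.isLE_of_isLE J hJ 0 h₁)
  have hY : F.acyclic Y :=
    Plus.TStructure.t.isLE_of_iso (F.rightDerivedFunctorPlus.mapIso e') 0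
  exact ⟨Y, hY, ⟨(Plus.singleFunctor B 0).preimageIso (F.acyclicIso.app ⟨Y, hY⟩ ≪≫
    F.rightDerivedFunctorPlus.mapIso e'.symm ≪≫ e)⟩⟩

/-- Dimension shifting: the kernel of an epimorphism from the image of an acyclic object to an
object of amplitude `k + 1` is of amplitude `k`. Indeed, if `Y` is in degrees `< -k`, morphisms
from the image of `Y` to the kernel factor through the shift by `-1` of the object of amplitude
`k + 1`, and they vanish. -/
lemma amplitude_X₁ (h : F.IsDerivedEquivalence p) (S : ShortComplex B) (hS : S.ShortExact)
    (N : A) (hN : F.acyclic N) (e : F.obj N ≅ S.X₂) (k : ℤ) (h₀ : 0 ≤ k)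
    (h₃ : amplitude F p (k + 1) S.X₃) :
    amplitude F p k S.X₁ := by
  obtain ⟨J, hJ, ⟨eJ⟩⟩ := h.exists_iso _ (Plus.boundedIf_single S.X₁ 0)
  obtain ⟨J₃, hJ₃, hJ₃', ⟨e₃⟩⟩ := h₃
  refine ⟨J, hJ, ?_, ⟨eJ⟩⟩
  change Plus.TStructure.t.IsGE J (-k)
  rw [Plus.TStructure.t.isGE_iff_orthogonal (-k - 1) (-k) (by lia)]
  intro Y f hY
  have hY' := Plus.boundedIf_of_isLE (p := p) Y _ hY
  apply (h.map_bijective _ _ hY' hJ).1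
  rw [Functor.map_zero, ← cancel_mono eJ.hom, zero_comp]
  obtain ⟨δ, hT⟩ := Plus.exists_distTriang_of_shortExact hS
  have h₂ : (F.rightDerivedFunctorPlus.map f ≫ eJ.hom) ≫ (Plus.singleFunctor B 0).map S.f = 0 := by
    let e₂ : F.rightDerivedFunctorPlus.obj ((Plus.singleFunctor A 0).obj N) ≅
        (Plus.singleFunctor B 0).obj S.X₂ :=
      (F.acyclicIso.app ⟨N, hN⟩).symm ≪≫ (Plus.singleFunctor B 0).mapIso e
    obtain ⟨g, hg⟩ := (h.map_bijective _ _ hY' (Plus.boundedIf_single N 0)).2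
      (((F.rightDerivedFunctorPlus.map f ≫ eJ.hom) ≫ (Plus.singleFunctor B 0).map S.f) ≫ e₂.inv)
    have hg' : g = 0 := Plus.TStructure.t.zero_of_isLE_of_isGE _ (-k - 1) 0 (by lia) hY
      inferInstance
    rw [← cancel_mono e₂.inv, zero_comp, ← hg, hg', Functor.map_zero]
  obtain ⟨g, i, hg⟩ : ∃ (g : F.rightDerivedFunctorPlus.obj Y ⟶
      ((Plus.singleFunctor B 0).obj S.X₃)⟦(-1 : ℤ)⟧) (i : _ ⟶ _),
      F.rightDerivedFunctorPlus.map f ≫ eJ.hom = g ≫ i := by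
    obtain ⟨g, hg⟩ := Triangle.coyoneda_exact₂ _ (inv_rot_of_distTriang _ hT)
      (F.rightDerivedFunctorPlus.map f ≫ eJ.hom) h₂
    exact ⟨g, _, hg⟩
  let e₄ : F.rightDerivedFunctorPlus.obj (J₃⟦(-1 : ℤ)⟧) ≅
      ((Plus.singleFunctor B 0).obj S.X₃)⟦(-1 : ℤ)⟧ :=
    (F.rightDerivedFunctorPlus.commShiftIso (-1 : ℤ)).app J₃ ≪≫
      (shiftFunctor _ (-1 : ℤ)).mapIso e₃
  obtain ⟨g', hg'⟩ := (h.map_bijective _ _ hY' (Plus.boundedIf_shift _ hJ₃ (-1))).2 (g ≫ e₄.inv)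
  have := Plus.TStructure.t.isGE_shift J₃ (-(k + 1)) (-1) (-k)
  have hg'' : g' = 0 := Plus.TStructure.t.zero_of_isLE_of_isGE _ (-k - 1) (-k) (by lia) hY
    inferInstance
  have : g = 0 := by
    rw [← cancel_mono e₄.inv, zero_comp, ← hg', hg'', Functor.map_zero]
  rw [hg, this, zero_comp]

end IsDerivedEquivalence

end CategoryTheory.Functor

/-! ### Covers by images of acyclic objects -/

namespace CategoryTheory.Functor

section

variable {A B : Type*} [Category* A] [Category* B] [Abelian A] [Abelian B]
  (F : A ⥤ B) [F.Additive]

/-- The inclusion of the cycles of the image of a complex by a functor. -/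
noncomputable def mapICycles (K : CochainComplex A ℤ) (i : ℤ) :
    ((F.mapHomologicalComplex (.up ℤ)).obj K).cycles i ⟶ F.obj (K.X i) :=
  ((F.mapHomologicalComplex (.up ℤ)).obj K).iCycles i

instance (K : CochainComplex A ℤ) (i : ℤ) : Mono (F.mapICycles K i) :=
  inferInstanceAs (Mono (((F.mapHomologicalComplex (.up ℤ)).obj K).iCycles i))

/-- The image by a functor of the cycles of a complex maps to the cycles of the image of
the complex. -/
noncomputable def mapCycles (K : CochainComplex A ℤ) (i : ℤ) :
    F.obj (K.cycles i) ⟶ ((F.mapHomologicalComplex (.up ℤ)).obj K).cycles i :=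
  ((F.mapHomologicalComplex (.up ℤ)).obj K).liftCycles (F.map (K.iCycles i)) (i + 1) (by simp)
    ((F.map_comp _ _).symm.trans ((congr_arg F.map (K.iCycles_d i (i + 1))).trans
      (F.map_zero _ _)))

lemma mapCycles_i (K : CochainComplex A ℤ) (i : ℤ) :
    F.mapCycles K i ≫ F.mapICycles K i = F.map (K.iCycles i) :=
  HomologicalComplex.liftCycles_i ..

lemma map_toCycles_mapCycles (K : CochainComplex A ℤ) (i j : ℤ) :
    F.map (K.toCycles i j) ≫ F.mapCycles K j =
      ((F.mapHomologicalComplex (.up ℤ)).obj K).toCycles i j :=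
  (cancel_mono (F.mapICycles K j)).1 ((by
    rw [Category.assoc, mapCycles_i, ← F.map_comp, K.toCycles_i] :
      (F.map (K.toCycles i j) ≫ F.mapCycles K j) ≫ F.mapICycles K j = F.map (K.d i j)).trans
    (((F.mapHomologicalComplex (.up ℤ)).obj K).toCycles_i i j).symm)

lemma mapCycles_naturality {K L : CochainComplex A ℤ} (f : K ⟶ L) (i : ℤ) :
    F.map (HomologicalComplex.cyclesMap f i) ≫ F.mapCycles L i =
      F.mapCycles K i ≫
        HomologicalComplex.cyclesMap ((F.mapHomologicalComplex (.up ℤ)).map f) i := by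
  rw [← cancel_mono (F.mapICycles L i), Category.assoc, Category.assoc, mapCycles_i]
  trans F.mapCycles K i ≫ F.mapICycles K i ≫ F.map (f.f i)
  · rw [← F.map_comp, HomologicalComplex.cyclesMap_i, F.map_comp, ← F.mapCycles_i K i,
      Category.assoc]
  · exact congr_arg _ (HomologicalComplex.cyclesMap_i
      ((F.mapHomologicalComplex (.up ℤ)).map f) i).symm

instance [PreservesFiniteLimits F] (K : CochainComplex A ℤ) (i : ℤ) :
    IsIso (F.mapCycles K i) := by
  let S := ShortComplex.mk (K.iCycles i) (K.d i (i + 1)) (by simp)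
  have hS : (S.map F).Exact :=
    (ShortComplex.exact_of_f_is_kernel S
      (K.cyclesIsKernel i (i + 1) (by simp))).map_of_mono_of_preservesKernel F
      (inferInstanceAs (Mono (K.iCycles i))) inferInstance
  have : Mono (S.map F).f := inferInstanceAs (Mono (F.map (K.iCycles i)))
  obtain ⟨l, hl⟩ : ∃ (l : ((F.mapHomologicalComplex (.up ℤ)).obj K).cycles i ⟶
      F.obj (K.cycles i)), l ≫ F.map (K.iCycles i) = F.mapICycles K i :=
    ⟨hS.lift (F.mapICycles K i) (HomologicalComplex.iCycles_d ..), hS.lift_f _ _⟩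
  refine ⟨l, ?_, ?_⟩
  · rw [← cancel_mono (F.map (K.iCycles i)), Category.assoc, hl, mapCycles_i, Category.id_comp]
  · rw [← cancel_mono (F.mapICycles K i), Category.assoc, mapCycles_i, hl, Category.id_comp]

end

variable {A B : Type*} [Category* A] [Category* B] [Abelian A] [Abelian B]
  [HasDerivedCategory A] [HasDerivedCategory B]
variable [EnoughInjectives A] {F : A ⥤ B} [F.Additive] {p : Prop}

namespace IsDerivedEquivalence

/-- If the right derived functor is an equivalence on bounded below derived categories, all
objects have bounded amplitude: otherwise, a direct sum of suitable shifts of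
objects of large amplitudes would not be in the essential image. -/
lemma exists_amplitude_bound (h : F.IsDerivedEquivalence False) :
    ∃ k : ℕ, ∀ X, amplitude F False k X := by
  by_contra! hn
  choose X hX using hn
  let Y : CochainComplex.Plus B :=
    ⟨{  X n := match n with
          | .ofNat n => X (2 * n)
          | .negSucc _ => 0
        d _ _ := 0 }, 0, by
      rw [CochainComplex.isStrictlyGE_iff]
      rintro (i | i) hi
      · lia
      · exact isZero_zero _⟩
  -- `Y` has zero differentials and `X (2 * n)` in degree `n`, so that `X (2 * c)`, placed
  -- in degree `c`, is a direct factor of `Y`, for `c` such that the object `J` which corresponds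
  -- to `Y` is in degrees `≥ -c`.
  have htop (Z : DerivedCategory.Plus A) : Plus.boundedIf False A Z := False.elim
  obtain ⟨J, -, ⟨e⟩⟩ := h.exists_iso (Plus.Q.obj Y) False.elim
  obtain ⟨m, hm⟩ := J.exists_isGE
  let c : ℕ := (-m).toNat
  have hJ : J.IsGE (-c) := Plus.TStructure.t.isGE_of_ge J _ m
  apply hX (2 * c)
  obtain ⟨J', -, ⟨e'⟩⟩ := h.exists_iso ((Plus.singleFunctor B 0).obj (X (2 * c))) False.elim
  refine ⟨J', htop _, ?_, ⟨e'⟩⟩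
  let K : CochainComplex.Plus B :=
    ⟨(CochainComplex.singleFunctor B (c : ℤ)).obj (X (2 * c)), c, inferInstance⟩
  let e'' : F.rightDerivedFunctorPlus.obj (J'⟦-(c : ℤ)⟧) ≅ Plus.Q.obj K :=
    (F.rightDerivedFunctorPlus.commShiftIso (-(c : ℤ))).app J' ≪≫
      (shiftFunctor _ (-(c : ℤ))).mapIso e' ≪≫
      ((Plus.singleFunctors B).shiftIso (-(c : ℤ)) c 0 (by simp)).app (X (2 * c))
  let i : K ⟶ Y := ObjectProperty.homMk
    (HomologicalComplex.mkHomFromSingle (K := Y.obj) (𝟙 (X (2 * c))) (fun k hk ↦ comp_zero))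
  let π : Y ⟶ K := ObjectProperty.homMk
    (HomologicalComplex.mkHomToSingle (K := Y.obj) (𝟙 (X (2 * c))) (fun k hk ↦ zero_comp))
  have hi : i ≫ π = 𝟙 K := by
    ext1
    apply HomologicalComplex.from_single_hom_ext
    refine (congr_arg₂ (· ≫ ·)
        (HomologicalComplex.mkHomFromSingle_f (K := Y.obj) _ (fun k hk ↦ comp_zero))
      (HomologicalComplex.mkHomToSingle_f (K := Y.obj) _ (fun k hk ↦ zero_comp))).trans ?_
    exact (congr_arg₂ (· ≫ ·) (Category.comp_id _) (Category.id_comp _)).trans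
      (Iso.hom_inv_id _)
  obtain ⟨i', hi'⟩ := (h.map_bijective _ _ (htop _) (htop _)).2 (e''.hom ≫ Plus.Q.map i ≫ e.inv)
  obtain ⟨π', hπ'⟩ := (h.map_bijective _ _ (htop _) (htop _)).2 (e.hom ≫ Plus.Q.map π ≫ e''.inv)
  have hi'' : i' ≫ π' = 𝟙 _ := by
    apply (h.map_bijective _ _ (htop _) (htop _)).1
    rw [Functor.map_comp, hi', hπ', Functor.map_id]
    simp [← Functor.map_comp_assoc, hi]
  -- The object `J'⟦-c⟧` is a direct factor of `J`, so that it is also in degrees `≥ -c`.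
  have hJ'' : Plus.TStructure.t.IsGE (J'⟦-(c : ℤ)⟧) (-c) := by
    rw [Plus.TStructure.t.isGE_iff_orthogonal (-c - 1) (-c) (by lia)]
    intro T f hT
    rw [← Category.comp_id f, ← hi'', ← Category.assoc,
      Plus.TStructure.t.zero_of_isLE_of_isGE (f ≫ i') (-c - 1) (-c) (by lia) hT hJ, zero_comp]
  exact Plus.TStructure.t.isGE_of_shift J' _ (-c) (-c)

/-- Any object of `B` corresponds under the equivalence to a bounded below complex of injective
objects. -/
lemma exists_injective_iso (h : F.IsDerivedEquivalence p) (X : B) :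
    ∃ K : CochainComplex.Plus A, (∀ n, Injective (K.obj.X n)) ∧
      Plus.boundedIf p A (Plus.Q.obj K) ∧
      Nonempty (F.rightDerivedFunctorPlus.obj (Plus.Q.obj K) ≅
        (Plus.singleFunctor B 0).obj X) := by
  obtain ⟨J, hJ, ⟨e⟩⟩ := h.exists_iso _ (Plus.boundedIf_single X 0)
  obtain ⟨n, hn⟩ := J.exists_isGE
  obtain ⟨L, hL, ⟨e'⟩⟩ := J.exists_injective_nonempty_iso n
  exact ⟨(InjectiveObject.ι A).mapCochainComplexPlus.obj L, fun n ↦ (L.obj.X n).property,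
    (Plus.boundedIf p A).prop_of_iso e'.symm hJ,
    ⟨F.rightDerivedFunctorPlus.mapIso e' ≪≫ e⟩⟩

end IsDerivedEquivalence

variable [PreservesFiniteLimits F]

/-- If a complex of acyclic objects has no cohomology in positive degrees, both before and after
applying `F`, then its cycles in degree `0` are acyclic: the vanishing of the right derived
functors in degree `n + 1` on the cycles in degrees `≥ 0` is obtained by induction on `n`, using
the short exact sequences between successive cycles. -/
lemma acyclic_cycles_zero (K : CochainComplex A ℤ) (hK : ∀ i, F.acyclic (K.X i))
    (h₁ : ∀ i > 0, K.ExactAt i)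
    (h₂ : ∀ i > 0, ((F.mapHomologicalComplex (.up ℤ)).obj K).ExactAt i) :
    F.acyclic (K.cycles 0) := by
  have hE (i j : ℤ) (hij : i + 1 = j) (hj : 0 < j) : Epi (F.map (K.toCycles i j)) := by
    have := CochainComplex.epi_toCycles _ i j hij (h₂ j hj)
    rw [← map_toCycles_mapCycles] at this
    exact (MorphismProperty.epimorphisms B).of_postcomp (W' := .isomorphisms B) _
      (F.mapCycles K j) (inferInstanceAs (IsIso _)) this
  have hX (i j : ℤ) (hj : 0 < j) : IsZero ((Plus.homologyFunctor B j).obj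
      (F.rightDerivedFunctorPlus.obj ((Plus.singleFunctor A 0).obj (K.X i)))) :=
    (Plus.isLE_iff _ 0).1 (hK i) j hj
  suffices ∀ (n : ℕ) (i : ℤ) (hi : 0 ≤ i), IsZero ((Plus.homologyFunctor B (n + 1)).obj
      (F.rightDerivedFunctorPlus.obj ((Plus.singleFunctor A 0).obj (K.cycles i)))) by
    refine (Plus.isLE_iff _ 0).2 (fun i hi ↦ ?_)
    obtain ⟨n, rfl⟩ := Int.le.dest (show 1 ≤ i by lia)
    rw [add_comm]
    exact this n 0 (by lia)
  intro n
  induction n with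
  | zero =>
    intro i hi
    obtain ⟨δ, hT⟩ := Plus.exists_distTriang_of_shortExact
      (K.shortExact_cycles i (i + 1) rfl (h₁ _ (by lia)))
    have hT' := F.rightDerivedFunctorPlus.map_distinguished _ hT
    have hδ := ((Plus.homologyFunctor B 0).homologySequence_epi_shift_map_mor₂_iff _ hT' 0 1
      (by lia)).1 ((epi_map_iff _).1 (hE i (i + 1) rfl (by lia)))
    have hm := ((Plus.homologyFunctor B 0).homologySequence_mono_shift_map_mor₁_iff _ hT' 0 1
      (by lia)).2 hδ
    exact @IsZero.of_mono _ _ _ _ _ _ hm (hX i 1 (by lia))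
  | succ n hn =>
    intro i hi
    obtain ⟨δ, hT⟩ := Plus.exists_distTriang_of_shortExact
      (K.shortExact_cycles i (i + 1) rfl (h₁ _ (by lia)))
    have hT' := F.rightDerivedFunctorPlus.map_distinguished _ hT
    have hex := (Plus.homologyFunctor B 0).homologySequence_exact₁ _ hT' (n + 1) (n + 2) (by lia)
    have := hex.isZero_X₂ ((hn (i + 1) (by lia)).eq_of_src _ _)
      ((hX i (n + 2) (by lia)).eq_of_tgt _ _)
    push_cast
    rwa [add_assoc]

variable (F) in
/-- If `K` is a complex, the image by a left exact functor of the cycles of `K` in degree `0`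
maps to the homology in degree `0` of the right derived functor applied to `K`. -/
noncomputable def mapCyclesToHomology :
    CochainComplex.Plus.ι A ⋙ HomologicalComplex.cyclesFunctor A (.up ℤ) 0 ⋙ F ⟶
      Plus.Q ⋙ F.rightDerivedFunctorPlus ⋙ Plus.homologyFunctor B 0 :=
  { app K := F.mapCycles K.obj 0
    naturality _ _ φ := F.mapCycles_naturality φ.hom 0 :
    CochainComplex.Plus.ι A ⋙ HomologicalComplex.cyclesFunctor A (.up ℤ) 0 ⋙ F ⟶
      F.mapCochainComplexPlus ⋙ CochainComplex.Plus.ι B ⋙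
        HomologicalComplex.cyclesFunctor B (.up ℤ) 0 } ≫
    whiskerLeft (F.mapCochainComplexPlus ⋙ CochainComplex.Plus.ι B)
      (HomologicalComplex.natTransHomologyπ B (.up ℤ) 0) ≫
    whiskerLeft F.mapCochainComplexPlus (Plus.homologyFunctorFactors 0).inv ≫
    whiskerRight F.toRightDerivedFunctorPlus (Plus.homologyFunctor B 0)

lemma epi_mapCyclesToHomology_app (K : CochainComplex.Plus A) (hK : ∀ i, F.acyclic (K.obj.X i)) :
    Epi (F.mapCyclesToHomology.app K) := by
  have := F.isIso_toRightDerivedFunctorPlus_app K hK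
  have h₁ : Epi (F.mapCycles K.obj 0) := inferInstance
  have h₂ : Epi ((F.mapCochainComplexPlus.obj K).obj.homologyπ 0) := inferInstance
  have h₃ : Epi ((Plus.homologyFunctorFactors 0).inv.app (F.mapCochainComplexPlus.obj K)) :=
    inferInstance
  have h₄ : Epi ((Plus.homologyFunctor B 0).map (F.toRightDerivedFunctorPlus.app K)) :=
    inferInstance
  have h₅ := @epi_comp _ _ _ _ _ _ h₃ _ h₄
  have h₆ := @epi_comp _ _ _ _ _ _ h₂ _ h₅
  exact @epi_comp _ _ _ _ _ _ h₁ _ h₆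

namespace IsDerivedEquivalence

/-- If the right derived functor is an equivalence (on bounded objects, or on all bounded below
objects), all objects `X` are quotients of images by `F` of
acyclic objects, and this cover is functorial in a weak sense. If `K` is a complex of injective
objects which corresponds to `X` under the equivalence, this cover is given by the cycles of `K`
in degree `0`. -/
lemma exists_cover (h : F.IsDerivedEquivalence p) :
    ∃ (N : B → A) (π : ∀ X, F.obj (N X) ⟶ X), (∀ X, F.acyclic (N X)) ∧ (∀ X, Epi (π X)) ∧
      (∀ X, IsZero X → IsZero (N X)) ∧
      ∀ (X Y : B) (f : X ⟶ Y), ∃ g : N X ⟶ N Y, F.map g ≫ π Y = π X ≫ f := by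
  choose K hK hK' hK'' using h.exists_injective_iso
  let e X := (hK'' X).some
  have hL (X) : (F.rightDerivedFunctorPlus.obj (Plus.Q.obj (K X))).IsLE 0 :=
    Plus.TStructure.t.isLE_of_iso (e X).symm 0
  have ha (X i) : F.acyclic ((K X).obj.X i) := by
    have := hK X i
    exact acyclic_of_injective _
  have hN (X) : F.acyclic ((K X).obj.cycles 0) := by
    apply acyclic_cycles_zero _ (ha X)
    · have := (Plus.isLE_Q_obj_iff (K X) 0).1 (h.isLE_of_isLE _ (hK' X) 0 (hL X))
      exact fun i hi ↦ (K X).obj.exactAt_of_isLE 0 i hi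
    · have := F.isIso_toRightDerivedFunctorPlus_app (K X) (ha X)
      have : Plus.IsLE ((Plus.Q ⋙ F.rightDerivedFunctorPlus).obj (K X)) 0 := hL X
      have : Plus.IsLE ((F.mapCochainComplexPlus ⋙ Plus.Q).obj (K X)) 0 :=
        Plus.TStructure.t.isLE_of_iso (asIso (F.toRightDerivedFunctorPlus.app (K X))).symm 0
      have : CochainComplex.IsLE ((F.mapHomologicalComplex (.up ℤ)).obj (K X).obj) 0 :=
        (Plus.isLE_Q_obj_iff (F.mapCochainComplexPlus.obj (K X)) 0).1 this
      exact fun i hi ↦ CochainComplex.exactAt_of_isLE _ 0 i hi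
  let ε := Plus.singleFunctorCompHomologyFunctorIso (C := B)
  let π₀ (X) : F.obj ((K X).obj.cycles 0) ⟶ X := F.mapCyclesToHomology.app (K X) ≫
    (Plus.homologyFunctor B 0).map (e X).hom ≫ ε.hom.app X
  have hπ₀ (X) : Epi (π₀ X) := by
    have h₁ := epi_mapCyclesToHomology_app (F := F) (K X) (ha X)
    have h₂ : Epi ((Plus.homologyFunctor B 0).map (e X).hom ≫ ε.hom.app X) := inferInstance
    exact @epi_comp _ _ _ _ _ _ h₁ _ h₂
  have hg (X Y) (f : X ⟶ Y) : ∃ g : (K X).obj.cycles 0 ⟶ (K Y).obj.cycles 0,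
      F.map g ≫ π₀ Y = π₀ X ≫ f := by
    obtain ⟨g, hg⟩ := (h.map_bijective _ _ (hK' X) (hK' Y)).2
      ((e X).hom ≫ (Plus.singleFunctor B 0).map f ≫ (e Y).inv)
    obtain ⟨g, rfl⟩ := (Plus.Qh_map_bijective_of_isKInjective
      ((HomotopyCategory.Plus.quotient A).obj (K X)) ((HomotopyCategory.Plus.quotient A).obj (K Y))
      (by
        obtain ⟨n, hn⟩ := (K Y).property
        have := hK Y
        exact CochainComplex.isKInjective_of_injective (K Y).obj n)).2 g
    obtain ⟨g, rfl⟩ := (HomotopyCategory.Plus.quotient A).map_surjective g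
    refine ⟨HomologicalComplex.cyclesMap g.hom 0, ?_⟩
    have h₁ : F.map (HomologicalComplex.cyclesMap g.hom 0) ≫ F.mapCyclesToHomology.app (K Y) =
      F.mapCyclesToHomology.app (K X) ≫ (Plus.homologyFunctor B 0).map
        (F.rightDerivedFunctorPlus.map (Plus.Q.map g)) := F.mapCyclesToHomology.naturality g
    have h₂ : F.rightDerivedFunctorPlus.map (Plus.Q.map g) ≫ (e Y).hom =
        (e X).hom ≫ (Plus.singleFunctor B 0).map f := by
      rw [← cancel_mono (e Y).inv, Category.assoc, Category.assoc, Iso.hom_inv_id, Category.comp_id]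
      exact hg
    have h₃ : (Plus.homologyFunctor B 0).map ((Plus.singleFunctor B 0).map f) ≫ ε.hom.app Y =
      ε.hom.app X ≫ f := ε.hom.naturality f
    refine (Category.assoc _ _ _).symm.trans ((congr_arg (· ≫ _) h₁).trans
      ((Category.assoc _ _ _).trans ?_))
    refine Eq.trans ?_ (Category.assoc _ _ _).symm
    refine congr_arg (F.mapCyclesToHomology.app (K X) ≫ ·) ?_
    rw [← Functor.map_comp_assoc, h₂, Functor.map_comp_assoc, h₃]
    exact (Category.assoc _ _ _).symm
  -- The zero object is treated separately: the cycles of `K X` may be nonzero when `X = 0`.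
  have key (X : B) : ∃ (N : A) (π : F.obj N ⟶ X) (i : N ⟶ (K X).obj.cycles 0)
      (r : (K X).obj.cycles 0 ⟶ N), F.acyclic N ∧ Epi π ∧ (IsZero X → IsZero N) ∧
      F.map i ≫ π₀ X = π ∧ F.map r ≫ π = π₀ X := by
    by_cases hX : IsZero X
    · exact ⟨0, 0, 0, 0, acyclic_of_isZero _ (isZero_zero A), hX.epi _,
        fun _ ↦ isZero_zero A, hX.eq_of_tgt _ _, hX.eq_of_tgt _ _⟩
    · exact ⟨_, π₀ X, 𝟙 _, 𝟙 _, hN X, hπ₀ X, fun hX' ↦ (hX hX').elim, by simp, by simp⟩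
  choose N π i r h₁ h₂ h₃ h₄ h₅ using key
  refine ⟨N, π, h₁, h₂, h₃, fun X Y f ↦ ?_⟩
  obtain ⟨g, hg⟩ := hg X Y f
  refine ⟨i X ≫ g ≫ r Y, ?_⟩
  rw [F.map_comp, F.map_comp, Category.assoc, Category.assoc, h₅, hg, reassoc_of% (h₄ X)]

end IsDerivedEquivalence

end CategoryTheory.Functor

/-! ### Complexes of representations, vertex by vertex -/

section

variable {J : Type*} [Category* J] {C : Type*} [Category* C]

/-- The functors `X : J ⥤ C` such that all the objects `X.obj j` satisfy a given property. -/
def CategoryTheory.ObjectProperty.pointwise (P : ObjectProperty C) (J : Type*) [Category* J] :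
    ObjectProperty (J ⥤ C) :=
  fun X ↦ ∀ j, P (X.obj j)

variable [Abelian C]

lemma CategoryTheory.ShortComplex.ShortExact.evaluation {S : ShortComplex (J ⥤ C)}
    (hS : S.ShortExact) (j : J) : (S.map ((evaluation J C).obj j)).ShortExact :=
  hS.map_of_exact _

namespace HomologicalComplex

lemma exactAt_iff_evaluation {ι : Type*} {c : ComplexShape ι} (K : HomologicalComplex (J ⥤ C) c)
    (i : ι) :
    K.ExactAt i ↔ ∀ j, ((((evaluation J C).obj j).mapHomologicalComplex c).obj K).ExactAt i := by
  have h (j : J) : ((((evaluation J C).obj j).mapHomologicalComplex c).obj K).ExactAt i ↔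
      IsZero ((K.sc i).homology.obj j) := by
    refine Iff.trans ?_ ((K.sc i).mapHomologyIso ((evaluation J C).obj j)).isZero_iff
    exact (ShortComplex.exact_iff_isZero_homology ((K.sc i).map ((evaluation J C).obj j)))
  rw [exactAt_iff, ShortComplex.exact_iff_isZero_homology, Functor.isZero_iff]
  simp only [h]

end HomologicalComplex

namespace CochainComplex

lemma isStrictlyGE_iff_evaluation (K : CochainComplex (J ⥤ C) ℤ) (n : ℤ) :
    K.IsStrictlyGE n ↔
      ∀ j, IsStrictlyGE ((((evaluation J C).obj j).mapHomologicalComplex (.up ℤ)).obj K) n := by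
  simp only [isStrictlyGE_iff, Functor.isZero_iff]
  exact ⟨fun h j i hi ↦ h i hi j, fun h i hi j ↦ h j i hi⟩

lemma isLE_iff_evaluation (K : CochainComplex (J ⥤ C) ℤ) (n : ℤ) :
    K.IsLE n ↔
      ∀ j, IsLE ((((evaluation J C).obj j).mapHomologicalComplex (.up ℤ)).obj K) n := by
  simp only [CochainComplex.isLE_iff, HomologicalComplex.exactAt_iff_evaluation]
  exact ⟨fun h j i hi ↦ h i hi j, fun h i hi j ↦ h j i hi⟩

/-- The complex of functors which corresponds to a functor to complexes. -/
def ofFunctor (T : J ⥤ CochainComplex C ℤ) : CochainComplex (J ⥤ C) ℤ where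
  X n := T ⋙ HomologicalComplex.eval C (.up ℤ) n
  d n m :=
    { app j := (T.obj j).d n m
      naturality _ _ f := (T.map f).comm n m }
  d_comp_d' n m l _ _ := by
    ext j
    exact (T.obj j).d_comp_d n m l
  shape n m h := by
    ext j
    exact (T.obj j).shape n m h

open HomotopicalAlgebra Plus.modelCategoryQuillen in
lemma Plus.exists_extension {K L I : CochainComplex.Plus C} (i : K ⟶ L) [Mono i]
    (hi : QuasiIso i.hom) (f : K ⟶ I) (hI : ∀ n, Injective (I.obj.X n)) :
    ∃ g : L ⟶ I, i ≫ g = f := by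
  have : WeakEquivalence i := (modelCategoryQuillen.weakEquivalence_iff i).2 hi
  have : IsFibrant I := (modelCategoryQuillen.isFibrant_iff I).2 hI
  have sq : CommSq f i (terminal.from I) (terminal.from L) := ⟨Subsingleton.elim _ _⟩
  exact ⟨sq.lift, sq.fac_left⟩

end CochainComplex

end

namespace QuiverRep

/-- A bounded below complex of representations of a quiver admits a quasi-isomorphism to a bounded
below complex of representations which are injective at each vertex: choose injective
resolutions at each vertex, and extend the action of the arrows to these resolutions. -/
lemma exists_quasiIso_injective {A : Type*} [Category* A] [Abelian A] [EnoughInjectives A]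
    {V : Type*} [Quiver V] (K : CochainComplex.Plus (QuiverRep V A)) :
    ∃ (L : CochainComplex.Plus (QuiverRep V A)) (f : K ⟶ L), QuasiIso f.hom ∧
      ∀ n, (ObjectProperty.pointwise (fun X : A ↦ Injective X) (Paths V)) (L.obj.X n) := by
  obtain ⟨n, hn⟩ := K.property
  have hn' (v : Paths V) : CochainComplex.IsStrictlyGE (K.obj.asFunctor.obj v) n :=
    (CochainComplex.isStrictlyGE_iff_evaluation K.obj n).1 hn v
  choose I i hi hi' hI hI' using fun v ↦
    CochainComplex.Plus.modelCategoryQuillen.exists_mono_quasiIso_injective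
      (K.obj.asFunctor.obj v) (n - 1) n (by lia)
  have key {v w : V} (a : v ⟶ w) : ∃ (g : I v ⟶ I w),
      i v ≫ g = K.obj.asFunctor.map a.toPath ≫ i w := by
    let K' (v : V) : CochainComplex.Plus A := ⟨K.obj.asFunctor.obj v, n, hn' v⟩
    let I' (v : V) : CochainComplex.Plus A := ⟨I v, n - 1, hI' v⟩
    let i' (v : V) : K' v ⟶ I' v := ObjectProperty.homMk (i v)
    have : Mono (i' v) := by
      rw [CochainComplex.Plus.mono_iff]
      exact hi v
    obtain ⟨g, hg⟩ := CochainComplex.Plus.exists_extension (i' v) (hi' v)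
      (ObjectProperty.homMk (K.obj.asFunctor.map a.toPath ≫ i w) : K' v ⟶ I' w) (hI w)
    exact ⟨g.hom, congr_arg (fun f ↦ f.hom) hg⟩
  choose g hg using @key
  let T : Paths V ⥤ CochainComplex A ℤ := Paths.lift { obj := I, map := g }
  let τ : K.obj.asFunctor ⟶ T := Paths.liftNatTrans i (fun a ↦ by
    dsimp only [T]
    rw [Paths.lift_toPath]
    exact (hg a).symm)
  refine ⟨⟨CochainComplex.ofFunctor T, n - 1,
    (CochainComplex.isStrictlyGE_iff_evaluation _ _).2 hI'⟩,
    ObjectProperty.homMk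
      { f m :=
          { app v := (τ.app v).f m
            naturality v w a := congr_arg (fun f ↦ f.f m) (τ.naturality a) }
        comm' m m' _ := by
          ext v
          exact (τ.app v).comm m m' },
    (HomologicalComplex.quasiIso_iff_evaluation _).2 hi', fun m v ↦ hI v m⟩

end QuiverRep

/-! ### Left resolutions of complexes of representations -/

section

lemma CategoryTheory.Paths.lift_comp_map_toPath {V : Type*} [Quiver V] {C D : Type*} [Category* C]
    [Category* D] (φ : V ⥤q C) (F : C ⥤ D) {v w : V} (a : v ⟶ w) :
    (Paths.lift φ ⋙ F).map a.toPath = F.map (φ.map a) :=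
  congr_arg F.map (Paths.lift_toPath φ a)

lemma CategoryTheory.Functor.isZero_of_isZero_obj {C D : Type*} [Category* C] [Category* D]
    [Preadditive C] (G : C ⥤ D) (P : ObjectProperty C)
    (hG : ∀ X Y, P X → P Y → Function.Bijective (G.map : (X ⟶ Y) → _))
    (X : C) (hX : P X) (h : IsZero (G.obj X)) : IsZero X := by
  rw [IsZero.iff_id_eq_zero]
  exact (hG X X hX hX).1 (h.eq_of_src _ _)

variable {C D : Type*} [Category* C] [Category* D] [Preadditive C] [Preadditive D]
  (G : C ⥤ D) [G.Additive] (P : ObjectProperty C)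

/-- If a functor is fully faithful on a class of objects, then complexes whose terms are in the
image of this class lift to complexes of objects in this class. -/
lemma CochainComplex.exists_mapHomologicalComplex_iso
    (hG : ∀ X Y, P X → P Y → Function.Bijective (G.map : (X ⟶ Y) → _))
    (L : CochainComplex D ℤ) (hL : ∀ n, ∃ X, P X ∧ Nonempty (G.obj X ≅ L.X n)) :
    ∃ K : CochainComplex C ℤ, (∀ n, P (K.X n)) ∧
      Nonempty ((G.mapHomologicalComplex (.up ℤ)).obj K ≅ L) := by
  choose X hX e using hL
  replace e n := (e n).some
  choose d hd using fun n m ↦ (hG (X n) (X m) (hX n) (hX m)).2 ((e n).hom ≫ L.d n m ≫ (e m).inv)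
  refine ⟨{ X := X, d := d, shape n m h := ?_, d_comp_d' n m l _ _ := ?_}, hX,
    ⟨HomologicalComplex.Hom.isoOfComponents e ?_⟩⟩
  · apply (hG _ _ (hX _) (hX _)).1
    rw [hd, L.shape n m h, zero_comp, comp_zero, G.map_zero]
  · apply (hG _ _ (hX _) (hX _)).1
    rw [G.map_comp, hd, hd, G.map_zero]
    simp
  · intro n m _
    refine Eq.symm ((congr_arg (· ≫ (e m).hom) (hd n m)).trans ?_)
    simp only [Category.assoc, Iso.inv_hom_id, Category.comp_id]
    rfl

end

namespace CategoryTheory.Functor.IsDerivedEquivalence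

variable {A B : Type*} [Category* A] [Category* B] [Abelian A] [Abelian B]
  [HasDerivedCategory A] [HasDerivedCategory B]
variable [EnoughInjectives A] {F : A ⥤ B} [F.Additive] {p : Prop}

lemma amplitude_of_isZero (X : B) (hX : IsZero X) (k : ℤ) (hk : 0 ≤ k) : amplitude F p k X :=
  ⟨(Plus.singleFunctor A 0).obj 0, Plus.boundedIf_single _ _,
    Plus.TStructure.t.isGE_of_ge _ (-k) 0,
    ⟨(F.rightDerivedFunctorPlus.map_isZero
      ((Plus.singleFunctor A 0).map_isZero (isZero_zero A))).iso
        ((Plus.singleFunctor B 0).map_isZero hX)⟩⟩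

variable {V : Type*} [Quiver V]

/-- The terms of a complex have uniformly bounded amplitudes at all the vertices. In the
bounded case, only finitely many objects are involved. -/
lemma exists_uniform_amplitude [Finite V] (h : F.IsDerivedEquivalence p)
    (Y : CochainComplex (QuiverRep V B) ℤ) (a : ℤ) [Y.IsStrictlyGE a]
    (hY : p → ∃ b, Y.IsStrictlyLE b) :
    ∃ k : ℕ, ∀ n, (amplitude F p k).pointwise _ (Y.X n) := by
  by_cases hp : p
  · obtain ⟨b, hb⟩ := hY hp
    choose k hk using fun (n : ℤ) (v : Paths V) ↦ h.exists_amplitude ((Y.X n).obj v)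
    have : Finite (Paths V) := inferInstanceAs (Finite V)
    obtain ⟨M, hM⟩ : ∃ M, ∀ x : Set.Icc a b × Paths V, k x.1 x.2 ≤ M :=
      (Set.finite_range (fun x : Set.Icc a b × Paths V ↦ k x.1 x.2)).bddAbove.imp
        (fun M hM x ↦ hM ⟨x, rfl⟩)
    refine ⟨M, fun n v ↦ ?_⟩
    by_cases hn : n ∈ Set.Icc a b
    · exact amplitude_monotone (by exact_mod_cast hM (⟨n, hn⟩, v)) _ (hk n v)
    · have hz : IsZero (Y.X n) := by
        simp only [Set.mem_Icc, not_and_or, not_le] at hn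
        obtain hn | hn := hn
        · exact Y.isZero_of_isStrictlyGE a n hn
        · exact Y.isZero_of_isStrictlyLE b n hn
      exact amplitude_of_isZero _ ((Functor.isZero_iff _).1 hz v) M (by simp)
  · obtain rfl : p = False := by simpa using hp
    obtain ⟨k, hk⟩ := h.exists_amplitude_bound
    exact ⟨k, fun n v ↦ hk _⟩

variable [PreservesFiniteLimits F]

lemma whiskeringRight_map_bijective (h : F.IsDerivedEquivalence p) {J : Type*} [Category* J]
    (X Y : J ⥤ A) (hX : F.acyclic.pointwise J X) (hY : F.acyclic.pointwise J Y) :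
    Function.Bijective (((whiskeringRight J A B).obj F).map : (X ⟶ Y) → _) := by
  refine ⟨fun f g hfg ↦ ?_, fun f ↦ ?_⟩
  · ext j
    exact (h.map_acyclic_bijective _ _ (hX j) (hY j)).1 (NatTrans.congr_app hfg j)
  · choose g hg using fun j ↦ (h.map_acyclic_bijective _ _ (hX j) (hY j)).2 (f.app j)
    refine ⟨{ app := g, naturality i j a := ?_ }, ?_⟩
    · apply (h.map_acyclic_bijective _ _ (hX i) (hY j)).1
      rw [F.map_comp, F.map_comp, hg, hg]
      exact f.naturality a
    · ext j
      exact hg j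

/-- Representations of amplitude `0` at each vertex are images of representations which are acyclic
at each vertex, as `F` is fully faithful on acyclic objects. -/
lemma exists_iso_of_amplitude_zero_pointwise (h : F.IsDerivedEquivalence p) (Y : QuiverRep V B)
    (hY : (amplitude F p 0).pointwise _ Y) :
    ∃ X, F.acyclic.pointwise _ X ∧ Nonempty ((F.quiverRep V).obj X ≅ Y) := by
  choose X hX e using fun v ↦ h.exists_iso_of_amplitude_zero (Y.obj v) (hY v)
  replace e v := (e v).some
  choose g hg using fun (v w : V) (a : v ⟶ w) ↦
    (h.map_acyclic_bijective _ _ (hX v) (hX w)).2 ((e v).hom ≫ Y.map a.toPath ≫ (e w).inv)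
  refine ⟨Paths.lift { obj := X, map a := g _ _ a }, hX,
    ⟨Paths.liftNatIso e (fun {v w} a ↦ ?_)⟩⟩
  refine (congr_arg (· ≫ (e w).hom)
    ((Paths.lift_comp_map_toPath _ F a).trans (hg _ _ a))).trans ?_
  refine (Category.assoc _ _ _).trans (congr_arg ((e v).hom ≫ ·) ?_)
  exact (Category.assoc _ _ _).trans
    ((congr_arg (Y.map a.toPath ≫ ·) (e w).inv_hom_id).trans (Category.comp_id _))

/-- The covers of the objects at the vertices extend to representations, as they are weakly
functorial and there are no relations between the arrows of a quiver. -/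
lemma exists_epi_quiverRep (h : F.IsDerivedEquivalence p) (Y : QuiverRep V B) :
    ∃ (X : QuiverRep V A) (π : (F.quiverRep V).obj X ⟶ Y),
      F.acyclic.pointwise _ X ∧ Epi π ∧ (IsZero Y → IsZero X) := by
  obtain ⟨N, π, hN, hπ, h₀, hg⟩ := h.exists_cover
  choose g hg using hg
  refine ⟨Paths.lift { obj v := N (Y.obj v), map a := g _ _ (Y.map a.toPath) },
    Paths.liftNatTrans (fun v ↦ π _) (fun {v w} a ↦ ?_), fun v ↦ hN _, ?_, fun h ↦ ?_⟩
  · exact (congr_arg (· ≫ π (Y.obj w)) (Paths.lift_comp_map_toPath _ F a)).trans (hg _ _ _)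
  · rw [NatTrans.epi_iff_epi_app]
    exact fun v ↦ hπ _
  · rw [Functor.isZero_iff] at h ⊢
    exact fun v ↦ h₀ _ (h v)

/-- A bounded below complex of representations in `B` (assumed to be bounded when `p` holds) has a
left resolution by the image of a complex of representations in `A` which are acyclic at
each vertex. -/
lemma exists_quasiIso_mapCochainComplexPlus [Finite V] (h : F.IsDerivedEquivalence p)
    (Y : CochainComplex.Plus (QuiverRep V B)) (hY : p → ∃ b, Y.obj.IsStrictlyLE b) :
    ∃ (X : CochainComplex.Plus (QuiverRep V A))
      (f : (F.quiverRep V).mapCochainComplexPlus.obj X ⟶ Y), QuasiIso f.hom ∧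
      (∀ n, F.acyclic.pointwise _ (X.obj.X n)) ∧ (p → ∃ b, X.obj.IsStrictlyLE b) := by
  obtain ⟨a, ha⟩ := Y.property
  obtain ⟨k, hk⟩ := h.exists_uniform_amplitude Y.obj a hY
  let E : ObjectProperty (QuiverRep V B) := fun Z ↦
    ∃ X, F.acyclic.pointwise _ X ∧ Nonempty ((F.quiverRep V).obj X ≅ Z)
  have : E.IsClosedUnderIsomorphisms :=
    ⟨fun e ⟨X, hX, ⟨e'⟩⟩ ↦ ⟨X, hX, ⟨e' ≪≫ e⟩⟩⟩
  obtain ⟨L, f, hf, hL, ⟨a', hL'⟩, hL''⟩ := CochainComplex.exists_quasiIso_of_objectProperty E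
    (by
      have := preservesBinaryBiproducts_of_preservesBiproducts (F.quiverRep V)
      have (v : Paths V) := preservesBinaryBiproducts_of_preservesBiproducts
        ((evaluation (Paths V) A).obj v)
      rintro Y₁ Y₂ ⟨X₁, h₁, ⟨e₁⟩⟩ ⟨X₂, h₂, ⟨e₂⟩⟩
      refine ⟨X₁ ⊞ X₂, fun v ↦ ?_, ⟨(F.quiverRep V).mapBiprod X₁ X₂ ≪≫ biprod.mapIso e₁ e₂⟩⟩
      exact F.acyclic.prop_of_iso (((evaluation _ A).obj v).mapBiprod X₁ X₂).symm
        (acyclic_biprod _ _ (h₁ v) (h₂ v)))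
    (fun k ↦ (amplitude F p k).pointwise _)
    (fun Y hY ↦ h.exists_iso_of_amplitude_zero_pointwise Y hY)
    (fun k Y hY ↦ by
      obtain ⟨X, π, hX, hπ, hX'⟩ := h.exists_epi_quiverRep Y
      exact ⟨_, π, ⟨X, hX, ⟨Iso.refl _⟩⟩, hπ, fun hY ↦ (F.quiverRep V).map_isZero (hX' hY)⟩)
    (fun k S hS ⟨X, hX, ⟨e⟩⟩ hS' v ↦
      h.amplitude_X₁ _ (hS.evaluation v) (X.obj v) (hX v) (e.app v) k (by simp) (hS' v))
    k Y.obj hk a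
  obtain ⟨K, hK, ⟨e⟩⟩ := CochainComplex.exists_mapHomologicalComplex_iso (F.quiverRep V)
    (F.acyclic.pointwise _) h.whiskeringRight_map_bijective L hL
  have hz (n : ℤ) (hn : IsZero (L.X n)) : IsZero (K.X n) :=
    (F.quiverRep V).isZero_of_isZero_obj (F.acyclic.pointwise _) h.whiskeringRight_map_bijective
      _ (hK n) (hn.of_iso ((HomologicalComplex.eval _ _ n).mapIso e))
  have hef : QuasiIso (e.hom ≫ f) := by
    have : QuasiIso e.hom := inferInstance
    infer_instance
  refine ⟨⟨K, a', ?_⟩, ObjectProperty.homMk (e.hom ≫ f), hef, hK, fun hp ↦ ?_⟩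
  · rw [CochainComplex.isStrictlyGE_iff]
    exact fun n hn ↦ hz n (L.isZero_of_isStrictlyGE a' n hn)
  · obtain ⟨b, hb⟩ := hY hp
    obtain ⟨b', hb'⟩ := hL'' b hb
    refine ⟨b', ?_⟩
    rw [CochainComplex.isStrictlyLE_iff]
    exact fun n hn ↦ hz n (L.isZero_of_isStrictlyLE b' n hn)

end CategoryTheory.Functor.IsDerivedEquivalence

/-! ### A criterion for equivalences between localized categories -/

namespace CategoryTheory.Functor.RestrictsToEquivalence

variable {K₁ K₂ D₁ D₂ : Type*} [Category* K₁] [Category* K₂] [Category* D₁] [Category* D₂]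
  {W₁ : MorphismProperty K₁} {W₂ : MorphismProperty K₂}
  {L₁ : K₁ ⥤ D₁} {L₂ : K₂ ⥤ D₂} [L₁.IsLocalization W₁] [L₂.IsLocalization W₂]
  [W₁.HasLeftCalculusOfFractions] [W₂.HasRightCalculusOfFractions]
  {G : K₁ ⥤ K₂} {R : D₁ ⥤ D₂} {S₁ : ObjectProperty D₁} {S₂ : ObjectProperty D₂}
  [S₁.IsClosedUnderIsomorphisms] [S₂.IsClosedUnderIsomorphisms]

/-- A criterion for a functor `R` between localized categories to restrict to an equivalence,
when it is computed by a functor `G` on a class `P` of objects which contains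
right resolutions. -/
lemma of_localization (α : G ⋙ L₂ ⟶ L₁ ⋙ R) (P : ObjectProperty K₁)
    (hα : ∀ x, P x → IsIso (α.app x))
    (hres : ∀ x, ∃ (y : K₁) (f : x ⟶ y), P y ∧ W₁ f)
    (hobj : ∀ x, P x → S₁ (L₁.obj x) → S₂ (L₂.obj (G.obj x)))
    (hcov : ∀ z, S₂ (L₂.obj z) → ∃ (x : K₁) (f : G.obj x ⟶ z), P x ∧ S₁ (L₁.obj x) ∧ W₂ f)
    (hG : ∀ x y, P x → P y → Function.Bijective (G.map : (x ⟶ y) → _))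
    (hiso : ∀ x y (f : x ⟶ y), P x → P y → S₁ (L₁.obj x) → S₁ (L₁.obj y) →
      IsIso (L₂.map (G.map f)) → IsIso (L₁.map f)) :
    R.RestrictsToEquivalence S₁ S₂ := by
  have hP (X : D₁) : ∃ x, P x ∧ Nonempty (L₁.obj x ≅ X) := by
    have := Localization.essSurj L₁ W₁
    obtain ⟨y, f, hy, hf⟩ := hres (L₁.objPreimage X)
    have := Localization.inverts L₁ W₁ f hf
    exact ⟨y, hy, ⟨(asIso (L₁.map f)).symm ≪≫ L₁.objObjPreimageIso X⟩⟩
  have nat {x y : K₁} (f : x ⟶ y) :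
      L₂.map (G.map f) ≫ α.app y = α.app x ≫ R.map (L₁.map f) := α.naturality f
  let iso (x) (hx : P x) : L₂.obj (G.obj x) ≅ R.obj (L₁.obj x) :=
    have := hα x hx
    asIso (α.app x)
  have hobj' (X : D₁) (hX : S₁ X) : S₂ (R.obj X) := by
    obtain ⟨x, hx, ⟨e⟩⟩ := hP X
    exact S₂.prop_of_iso (iso x hx ≪≫ R.mapIso e) (hobj x hx (S₁.prop_of_iso e.symm hX))
  have hdom (x : K₁) (hx : P x) (hx' : S₁ (L₁.obj x)) {z : K₂} (s : z ⟶ G.obj x) (hs : W₂ s) :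
      ∃ (x' : K₁) (f : G.obj x' ⟶ z) (t : x' ⟶ x), P x' ∧ IsIso (L₁.map t) ∧
        f ≫ s = G.map t := by
    have hs' := Localization.inverts L₂ W₂ s hs
    obtain ⟨x', f, h₁, h₂, hf⟩ := hcov z
      (S₂.prop_of_iso (asIso (L₂.map s)).symm (hobj x hx hx'))
    have hf' := Localization.inverts L₂ W₂ f hf
    obtain ⟨t, ht⟩ := (hG x' x h₁ hx).2 (f ≫ s)
    refine ⟨x', f, t, h₁, hiso _ _ t h₁ hx h₂ hx' ?_, ht.symm⟩
    rw [ht, L₂.map_comp]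
    infer_instance
  have hinj (x y : K₁) (hx : P x) (hx' : S₁ (L₁.obj x))
      (f g : L₁.obj x ⟶ L₁.obj y) (hfg : R.map f = R.map g) : f = g := by
    obtain ⟨w, σ, a, b, hw, hσ, ha, hb⟩ : ∃ (w : K₁) (σ : y ⟶ w) (a b : x ⟶ w), P w ∧
        IsIso (L₁.map σ) ∧ f ≫ L₁.map σ = L₁.map a ∧ g ≫ L₁.map σ = L₁.map b := by
      obtain ⟨φ, hφ⟩ := Localization.exists_leftFraction L₁ W₁ f
      have := Localization.inverts L₁ W₁ φ.s φ.hs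
      obtain ⟨ψ, hψ⟩ := Localization.exists_leftFraction L₁ W₁ (g ≫ L₁.map φ.s)
      have := Localization.inverts L₁ W₁ ψ.s ψ.hs
      obtain ⟨w, τ, hw, hτ⟩ := hres ψ.Y'
      have := Localization.inverts L₁ W₁ τ hτ
      have hφ' : f ≫ L₁.map φ.s = L₁.map φ.f := by rw [hφ, φ.map_comp_map_s]
      have hψ' : g ≫ L₁.map φ.s ≫ L₁.map ψ.s = L₁.map ψ.f := by
        rw [← Category.assoc, hψ, ψ.map_comp_map_s]
      refine ⟨w, φ.s ≫ ψ.s ≫ τ, φ.f ≫ ψ.s ≫ τ, ψ.f ≫ τ, hw, ?_, ?_, ?_⟩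
      · rw [L₁.map_comp, L₁.map_comp]
        infer_instance
      · rw [L₁.map_comp, L₁.map_comp φ.f, reassoc_of% hφ']
      · simp only [L₁.map_comp, ← hψ', Category.assoc]
    have := hα w hw
    have hab : L₂.map (G.map a) = L₂.map (G.map b) := by
      rw [← cancel_mono (α.app w)]
      refine (nat a).trans (Eq.trans ?_ (nat b).symm)
      rw [← ha, ← hb, R.map_comp, R.map_comp, hfg]
    obtain ⟨z, s, hs, hs'⟩ := (MorphismProperty.map_eq_iff_precomp L₂ W₂ _ _).1 hab
    obtain ⟨x', f', t, hx'', ht, ht'⟩ := hdom x hx hx' s hs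
    have hab' : t ≫ a = t ≫ b := (hG x' w hx'' hw).1 (by
      rw [G.map_comp, G.map_comp, ← ht', Category.assoc, Category.assoc, hs'])
    rw [← cancel_mono (L₁.map σ), ha, hb, ← cancel_epi (L₁.map t), ← L₁.map_comp, hab',
      L₁.map_comp]
  have hsurj (x y : K₁) (hx : P x) (hx' : S₁ (L₁.obj x)) (hy : P y)
      (g : R.obj (L₁.obj x) ⟶ R.obj (L₁.obj y)) : ∃ f, R.map f = g := by
    obtain ⟨g', hg'⟩ : ∃ g' : L₂.obj (G.obj x) ⟶ L₂.obj (G.obj y),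
        g' ≫ α.app y = α.app x ≫ g :=
      ⟨α.app x ≫ g ≫ (iso y hy).inv, by
        rw [Category.assoc, Category.assoc]
        exact congr_arg (α.app x ≫ ·)
          ((congr_arg (g ≫ ·) (iso y hy).inv_hom_id).trans (Category.comp_id _))⟩
    obtain ⟨φ, hφ⟩ := Localization.exists_rightFraction L₂ W₂ g'
    have hφ' : L₂.map φ.s ≫ g' = L₂.map φ.f := by rw [hφ, φ.map_s_comp_map]
    obtain ⟨x', f', t, hx'', ht, ht'⟩ := hdom x hx hx' φ.s φ.hs
    obtain ⟨u, hu⟩ := (hG x' y hx'' hy).2 (f' ≫ φ.f)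
    have := hα x' hx''
    refine ⟨CategoryTheory.inv (L₁.map t) ≫ L₁.map u, ?_⟩
    rw [← cancel_epi (R.map (L₁.map t)), ← R.map_comp, IsIso.hom_inv_id_assoc,
      ← cancel_epi (α.app x')]
    refine (nat u).symm.trans ?_
    have h₁ := congr_arg (· ≫ g) (nat t)
    rw [Category.assoc, Category.assoc, ← hg', ← ht', L₂.map_comp, Category.assoc] at h₁
    rw [hu, L₂.map_comp, Category.assoc, ← hφ', Category.assoc]
    exact h₁
  refine ⟨hobj', fun X Y hX hY ↦ ?_, fun Z hZ ↦ ?_⟩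
  · obtain ⟨x, hx, ⟨e⟩⟩ := hP X
    obtain ⟨y, hy, ⟨e'⟩⟩ := hP Y
    have hx' := S₁.prop_of_iso e.symm hX
    refine ⟨fun f g hfg ↦ ?_, fun f ↦ ?_⟩
    · rw [← cancel_mono e'.inv, ← cancel_epi e.hom]
      apply hinj x y hx hx'
      simp only [R.map_comp, hfg]
    · obtain ⟨g, hg⟩ := hsurj x y hx hx' hy (R.map e.hom ≫ f ≫ R.map e'.inv)
      exact ⟨e.inv ≫ g ≫ e'.hom, by simp [hg, ← R.map_comp, ← R.map_comp_assoc]⟩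
  · have := Localization.essSurj L₂ W₂
    obtain ⟨x, f, h₁, h₂, hf⟩ := hcov (L₂.objPreimage Z)
      (S₂.prop_of_iso (L₂.objObjPreimageIso Z).symm hZ)
    have := Localization.inverts L₂ W₂ f hf
    exact ⟨L₁.obj x, h₂, ⟨(iso x h₁).symm ≪≫ asIso (L₂.map f) ≪≫ L₂.objObjPreimageIso Z⟩⟩

end CategoryTheory.Functor.RestrictsToEquivalence

/-! ### Derived equivalences for representations -/

namespace HomotopyCategory.Plus

instance (C : Type*) [Category* C] [Abelian C] :
    (quasiIso C).HasLeftCalculusOfFractions := by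
  rw [quasiIso_eq_subcategoryAcyclic_trW]
  infer_instance

instance (C : Type*) [Category* C] [Abelian C] :
    (quasiIso C).HasRightCalculusOfFractions := by
  rw [quasiIso_eq_subcategoryAcyclic_trW]
  infer_instance

/-- The complexes whose terms satisfy a given property. -/
def termwise {C : Type*} [Category* C] [Preadditive C] (P : ObjectProperty C) :
    ObjectProperty (HomotopyCategory.Plus C) :=
  fun x ↦ ∀ n, P (x.obj.as.X n)

lemma quasiIso_quotient_map_iff {C : Type*} [Category* C] [Abelian C]
    {K L : CochainComplex.Plus C} (f : K ⟶ L) :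
    quasiIso C ((quotient C).map f) ↔ QuasiIso f.hom :=
  (quasiIso_iff _ _).trans (HomotopyCategory.quotient_map_mem_quasiIso_iff f.hom)

/-- If a functor is fully faithful on a class of objects, it is also fully faithful, up to homotopy,
on bounded below complexes with terms in this class. -/
lemma mapHomotopyCategoryPlus_map_bijective {C D : Type*} [Category* C] [Category* D]
    [Preadditive C] [Preadditive D] (G : C ⥤ D) [G.Additive] (P : ObjectProperty C)
    (hG : ∀ X Y, P X → P Y → Function.Bijective (G.map : (X ⟶ Y) → _))
    (x y : HomotopyCategory.Plus C) (hx : termwise P x) (hy : termwise P y) :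
    Function.Bijective (G.mapHomotopyCategoryPlus.map : (x ⟶ y) → _) := by
  have : (P.ι ⋙ G).Full :=
    ⟨fun {X Y} f ↦ ⟨ObjectProperty.homMk ((hG _ _ X.property Y.property).2 f).choose,
      ((hG _ _ X.property Y.property).2 f).choose_spec⟩⟩
  have : (P.ι ⋙ G).Faithful :=
    ⟨fun {X Y f g} h ↦ by
      ext
      exact (hG _ _ X.property Y.property).1 h⟩
  obtain ⟨K, rfl⟩ := quotient_obj_surjective x
  obtain ⟨L, rfl⟩ := quotient_obj_surjective y
  let lift (M : CochainComplex.Plus C) (hM : ∀ n, P (M.obj.X n)) :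
      HomotopyCategory.Plus P.FullSubcategory :=
    (quotient _).obj ⟨{
      X n := ⟨M.obj.X n, hM n⟩
      d i j := ObjectProperty.homMk (M.obj.d i j)
      shape i j h := by ext; exact M.obj.shape i j h
      d_comp_d' i j k _ _ := by ext; exact M.obj.d_comp_d i j k }, by
        obtain ⟨n, hn⟩ := M.property
        refine ⟨n, ?_⟩
        rw [CochainComplex.isStrictlyGE_iff]
        intro i hi
        rw [IsZero.iff_id_eq_zero]
        ext
        exact (M.obj.isZero_of_isStrictlyGE n i hi).eq_of_src _ _⟩
  have h₁ := ((Functor.FullyFaithful.ofFullyFaithful P.ι.mapHomotopyCategoryPlus).map_bijective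
    (lift K hx) (lift L hy))
  have h₂ := ((Functor.FullyFaithful.ofFullyFaithful
    (P.ι ⋙ G).mapHomotopyCategoryPlus).map_bijective (lift K hx) (lift L hy))
  refine (Function.Bijective.of_comp_iff _ h₁).1 ?_
  refine (congrArg Function.Bijective (funext fun f ↦ ?_)).mpr h₂
  obtain ⟨f, rfl⟩ := (quotient _).map_surjective f
  rfl

end HomotopyCategory.Plus

/-- A bounded below complex with bounded cohomology can be replaced by a bounded complex, by a
canonical truncation. -/
lemma CochainComplex.Plus.exists_quasiIso_of_boundedIf {C : Type*} [Category* C] [Abelian C]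
    [HasDerivedCategory C] {p : Prop} (Z : CochainComplex.Plus C)
    (hZ : Plus.boundedIf p C (Plus.Q.obj Z)) :
    ∃ (Z' : CochainComplex.Plus C) (f : Z' ⟶ Z), QuasiIso f.hom ∧
      (p → ∃ b, Z'.obj.IsStrictlyLE b) := by
  by_cases hp : p
  · obtain ⟨b, hb⟩ := hZ hp
    have : Z.obj.IsLE b := (Plus.isLE_Q_obj_iff _ _).1 hb
    obtain ⟨a, ha⟩ := Z.property
    exact ⟨⟨Z.obj.truncLE b, a, inferInstance⟩, ObjectProperty.homMk (Z.obj.ιTruncLE b),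
      (Z.obj.quasiIso_ιTruncLE_iff b).2 inferInstance, fun _ ↦ ⟨b, inferInstance⟩⟩
  · exact ⟨Z, 𝟙 Z, inferInstanceAs (QuasiIso (𝟙 Z.obj)), fun h ↦ (hp h).elim⟩

lemma DerivedCategory.Plus.boundedIf_evaluation {J C : Type*} [Category* J] [Category* C]
    [Abelian C] [HasDerivedCategory C] [HasDerivedCategory (J ⥤ C)] {p : Prop}
    {K : CochainComplex.Plus (J ⥤ C)} (hK : Plus.boundedIf p _ (Plus.Q.obj K)) (j : J) :
    Plus.boundedIf p C (Plus.Q.obj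
      (((evaluation J C).obj j).mapCochainComplexPlus.obj K)) := by
  intro hp
  obtain ⟨n, hn⟩ := hK hp
  exact ⟨n, (Plus.isLE_Q_obj_iff _ _).2 ((CochainComplex.isLE_iff_evaluation _ _).1
    ((Plus.isLE_Q_obj_iff _ _).1 hn) j)⟩

lemma CategoryTheory.Functor.RestrictsToEquivalence.isIso_of_isIso_map {C D : Type*} [Category* C]
    [Category* D] {G : C ⥤ D} {P : ObjectProperty C} {P' : ObjectProperty D}
    (h : G.RestrictsToEquivalence P P') {X Y : C} (f : X ⟶ Y) (hX : P X) (hY : P Y)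
    [IsIso (G.map f)] : IsIso f := by
  obtain ⟨g, hg⟩ := (h.map_bijective Y X hY hX).2 (CategoryTheory.inv (G.map f))
  refine ⟨g, ?_, ?_⟩
  · apply (h.map_bijective _ _ hX hX).1
    simp [hg]
  · apply (h.map_bijective _ _ hY hY).1
    simp [hg]

namespace CategoryTheory.Functor

variable {A B : Type*} [Category* A] [Category* B] [Abelian A] [Abelian B]
  [HasDerivedCategory A] [HasDerivedCategory B]
variable [EnoughInjectives A] {F : A ⥤ B} [F.Additive] {p : Prop}
  {V : Type*} [Quiver V]

variable (F V) in
/-- Bounded below complexes of representations which are acyclic at each vertex, as a full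
subcategory of the homotopy category. -/
abbrev acyclicComplexes : ObjectProperty (HomotopyCategory.Plus (QuiverRep V A)) :=
  HomotopyCategory.Plus.termwise (F.acyclic.pointwise _)

variable (F V) in
/-- The inclusion of the bounded below complexes of representations which are acyclic at each
vertex. -/
abbrev acyclicComplexesLocalizerMorphism :
    LocalizerMorphism ((HomotopyCategory.Plus.quasiIso (QuiverRep V A)).inverseImage
      (acyclicComplexes F V).ι) (HomotopyCategory.Plus.quasiIso (QuiverRep V A)) where
  functor := (acyclicComplexes F V).ι
  map := le_rfl

lemma exists_quasiIso_acyclicComplexes (x : HomotopyCategory.Plus (QuiverRep V A)) :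
    ∃ (y : HomotopyCategory.Plus (QuiverRep V A)) (f : x ⟶ y), acyclicComplexes F V y ∧
      HomotopyCategory.Plus.quasiIso _ f := by
  obtain ⟨K, rfl⟩ := HomotopyCategory.Plus.quotient_obj_surjective x
  obtain ⟨L, f, hf, hL⟩ := QuiverRep.exists_quasiIso_injective K
  refine ⟨_, (HomotopyCategory.Plus.quotient _).map f, fun n v ↦ ?_,
    (HomotopyCategory.Plus.quasiIso_quotient_map_iff f).2 hf⟩
  have : Injective ((L.obj.X n).obj v) := hL n v
  exact F.acyclic_of_injective ((L.obj.X n).obj v)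

instance : (acyclicComplexesLocalizerMorphism F V).IsInduced where
  inverseImage_eq := rfl

instance : (acyclicComplexesLocalizerMorphism F V).HasRightResolutions := fun x ↦ by
  obtain ⟨y, f, hy, hf⟩ := exists_quasiIso_acyclicComplexes (F := F) x
  exact ⟨{ X₁ := ⟨y, hy⟩, w := f, hw := hf }⟩

instance : (acyclicComplexesLocalizerMorphism F V).functor.Full :=
  inferInstanceAs (acyclicComplexes F V).ι.Full

instance : (acyclicComplexesLocalizerMorphism F V).functor.Faithful :=
  inferInstanceAs (acyclicComplexes F V).ι.Faithful

instance : (acyclicComplexesLocalizerMorphism F V).IsRightDerivabilityStructure :=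
  LocalizerMorphism.isRightDerivabilityStructure_of_hasRightResolutions _

variable [PreservesFiniteLimits F]

section

variable {K L : CochainComplex.Plus (QuiverRep V A)}

lemma quasiIso_quiverRep_map (f : K ⟶ L) (hK : ∀ n, F.acyclic.pointwise _ (K.obj.X n))
    (hL : ∀ n, F.acyclic.pointwise _ (L.obj.X n)) (hf : QuasiIso f.hom) :
    QuasiIso ((F.quiverRep V).mapCochainComplexPlus.map f).hom := by
  refine (HomologicalComplex.quasiIso_iff_evaluation _).2 fun v ↦ ?_
  obtain ⟨a, ha⟩ := K.property
  obtain ⟨b, hb⟩ := L.property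
  have : CochainComplex.IsStrictlyGE ((((evaluation (Paths V) A).obj v).mapHomologicalComplex
      (.up ℤ)).obj K.obj) (min (a - 1) b + 1) := by
    have := K.obj.isStrictlyGE_of_ge (min (a - 1) b + 1) a (by lia)
    exact (CochainComplex.isStrictlyGE_iff_evaluation _ _).1 this v
  have : CochainComplex.IsStrictlyGE ((((evaluation (Paths V) A).obj v).mapHomologicalComplex
      (.up ℤ)).obj L.obj) (min (a - 1) b) := by
    have := L.obj.isStrictlyGE_of_ge (min (a - 1) b) b (by lia)
    exact (CochainComplex.isStrictlyGE_iff_evaluation _ _).1 this v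
  exact F.quasiIso_mapHomologicalComplex_map
    ((((evaluation (Paths V) A).obj v).mapHomologicalComplex (.up ℤ)).map f.hom)
    (min (a - 1) b) (fun n ↦ hK n v) (fun n ↦ hL n v)
    ((HomologicalComplex.quasiIso_iff_evaluation _).1 hf v)

variable [HasDerivedCategory (QuiverRep V A)]

namespace IsDerivedEquivalence

/-- Quasi-isomorphisms between complexes of acyclic representations are detected after applying `F`:
this can be checked at each vertex, where the right derived functor of `F` is
conservative. -/
lemma quasiIso_of_quiverRep_map (h : F.IsDerivedEquivalence p) (f : K ⟶ L)
    (hK : ∀ n, F.acyclic.pointwise _ (K.obj.X n))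
    (hL : ∀ n, F.acyclic.pointwise _ (L.obj.X n))
    (hK' : Plus.boundedIf p _ (Plus.Q.obj K)) (hL' : Plus.boundedIf p _ (Plus.Q.obj L))
    (hf : QuasiIso ((F.quiverRep V).mapCochainComplexPlus.map f).hom) :
    QuasiIso f.hom := by
  refine (HomologicalComplex.quasiIso_iff_evaluation _).2 fun v ↦ ?_
  let E := ((evaluation (Paths V) A).obj v).mapCochainComplexPlus
  have := F.isIso_toRightDerivedFunctorPlus_app (E.obj K) (fun n ↦ hK n v)
  have := F.isIso_toRightDerivedFunctorPlus_app (E.obj L) (fun n ↦ hL n v)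
  have : IsIso (Plus.Q.map (F.mapCochainComplexPlus.map (E.map f))) :=
    (Plus.isIso_Q_map_iff _).2 ((HomologicalComplex.quasiIso_iff_evaluation _).1 hf v)
  have nat : Plus.Q.map (F.mapCochainComplexPlus.map (E.map f)) ≫
      F.toRightDerivedFunctorPlus.app (E.obj L) = F.toRightDerivedFunctorPlus.app (E.obj K) ≫
      F.rightDerivedFunctorPlus.map (Plus.Q.map (E.map f)) :=
    F.toRightDerivedFunctorPlus.naturality (E.map f)
  have : IsIso (F.rightDerivedFunctorPlus.map (Plus.Q.map (E.map f))) :=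
    IsIso.of_isIso_fac_left nat.symm
  exact (Plus.isIso_Q_map_iff (E.map f)).1
    (h.isIso_of_isIso_map _ (Plus.boundedIf_evaluation hK' v) (Plus.boundedIf_evaluation hL' v))

lemma boundedIf_quiverRep_obj [HasDerivedCategory (QuiverRep V B)] [Finite V]
    (h : F.IsDerivedEquivalence p)
    (hK : ∀ n, F.acyclic.pointwise _ (K.obj.X n))
    (hK' : Plus.boundedIf p _ (Plus.Q.obj K)) :
    Plus.boundedIf p _ (Plus.Q.obj ((F.quiverRep V).mapCochainComplexPlus.obj K)) := by
  intro hp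
  let E (v) := ((evaluation (Paths V) A).obj v).mapCochainComplexPlus
  have (v : Paths V) : ∃ n, (Plus.Q.obj (F.mapCochainComplexPlus.obj ((E v).obj K))).IsLE n := by
    have := F.isIso_toRightDerivedFunctorPlus_app ((E v).obj K) (fun n ↦ hK n v)
    exact (Plus.boundedIf p B).prop_of_iso
      (asIso (F.toRightDerivedFunctorPlus.app ((E v).obj K))).symm
      (h.prop_obj _ (Plus.boundedIf_evaluation hK' v)) hp
  choose n hn using this
  have : Finite (Paths V) := inferInstanceAs (Finite V)
  obtain ⟨M, hM⟩ := (Set.finite_range n).bddAbove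
  refine ⟨M, (Plus.isLE_Q_obj_iff _ _).2 ((CochainComplex.isLE_iff_evaluation _ _).2
    (fun v ↦ (Plus.isLE_Q_obj_iff (F.mapCochainComplexPlus.obj ((E v).obj K)) M).1 ?_))⟩
  have := hn v
  exact Plus.TStructure.t.isLE_of_le _ (n v) M (hM ⟨v, rfl⟩)

end IsDerivedEquivalence

end

variable [HasDerivedCategory (QuiverRep V B)]

variable (F V) in
lemma acyclicComplexes_derives : (acyclicComplexesLocalizerMorphism F V).Derives
    ((F.quiverRep V).mapHomotopyCategoryPlus ⋙ Plus.Qh) := by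
  rintro ⟨x, hx⟩ ⟨y, hy⟩ ⟨f⟩ hf
  obtain ⟨K, rfl⟩ := HomotopyCategory.Plus.quotient_obj_surjective x
  obtain ⟨L, rfl⟩ := HomotopyCategory.Plus.quotient_obj_surjective y
  obtain ⟨f, rfl⟩ := (HomotopyCategory.Plus.quotient _).map_surjective f
  exact (Plus.isIso_Q_map_iff _).2 (quasiIso_quiverRep_map f hx hy
    ((HomotopyCategory.Plus.quasiIso_quotient_map_iff f).1 hf))

variable [HasDerivedCategory (QuiverRep V A)]

variable (F V) in
lemma exists_isRightDerivedFunctorPlus_quiverRep :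
    ∃ RFV, (F.quiverRep V).IsRightDerivedFunctorPlus RFV := by
  have := (acyclicComplexes_derives F V).hasPointwiseRightDerivedFunctor
  exact ⟨_, Functor.totalRightDerivedUnit _ Plus.Qh (HomotopyCategory.Plus.quasiIso _),
    inferInstance⟩

/-- If the right derived functor of `F` is an equivalence (on bounded objects when `p` holds), then
so is the right derived functor of the functor induced on representations. -/
lemma IsDerivedEquivalence.quiverRep [Finite V] (h : F.IsDerivedEquivalence p)
    (RFV : DerivedCategory.Plus (QuiverRep V A) ⥤ DerivedCategory.Plus (QuiverRep V B))
    (hRFV : (F.quiverRep V).IsRightDerivedFunctorPlus RFV) :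
    RFV.RestrictsToEquivalence (Plus.boundedIf p _) (Plus.boundedIf p _) := by
  obtain ⟨α, hα⟩ := hRFV
  refine RestrictsToEquivalence.of_localization
    (W₁ := HomotopyCategory.Plus.quasiIso _) (W₂ := HomotopyCategory.Plus.quasiIso _)
    α (acyclicComplexes F V)
    (fun x hx ↦ (acyclicComplexes_derives F V).isIso_of_isRightDerivedFunctor α ⟨x, hx⟩)
    exists_quasiIso_acyclicComplexes (fun x hx hx' ↦ ?_) (fun z hz ↦ ?_)
    (HomotopyCategory.Plus.mapHomotopyCategoryPlus_map_bijective _ _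
      h.whiskeringRight_map_bijective) (fun x y f hx hy hx' hy' hf ↦ ?_)
  · obtain ⟨K, rfl⟩ := HomotopyCategory.Plus.quotient_obj_surjective x
    exact h.boundedIf_quiverRep_obj hx hx'
  · obtain ⟨Z, rfl⟩ := HomotopyCategory.Plus.quotient_obj_surjective z
    obtain ⟨Z', g, hg, hZ'⟩ := Z.exists_quasiIso_of_boundedIf hz
    obtain ⟨K, f, hf, hK, hK'⟩ := h.exists_quasiIso_mapCochainComplexPlus Z' hZ'
    refine ⟨(HomotopyCategory.Plus.quotient _).obj K,
      (HomotopyCategory.Plus.quotient _).map (f ≫ g), hK, fun hp ↦ ?_,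
      (HomotopyCategory.Plus.quasiIso_quotient_map_iff _).2 (quasiIso_comp f.hom g.hom)⟩
    obtain ⟨b, hb⟩ := hK' hp
    exact ⟨b, (Plus.isLE_Q_obj_iff K b).2 inferInstance⟩
  · obtain ⟨K, rfl⟩ := HomotopyCategory.Plus.quotient_obj_surjective x
    obtain ⟨L, rfl⟩ := HomotopyCategory.Plus.quotient_obj_surjective y
    obtain ⟨f, rfl⟩ := (HomotopyCategory.Plus.quotient _).map_surjective f
    exact (Plus.isIso_Q_map_iff f).2 (h.quasiIso_of_quiverRep_map f hx hy hx' hy'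
      ((Plus.isIso_Q_map_iff _).1 hf))

end CategoryTheory.Functor

theorem theorem24
    {A B : Type*} [Category* A] [Category* B] [Abelian A] [Abelian B] [EnoughInjectives A]
    (F : A ⥤ B) [F.Additive] [PreservesFiniteLimits F]
    (V : Type*) [Quiver V] [Finite V] [∀ i j : V, Finite (i ⟶ j)]
    [HasDerivedCategory A] [HasDerivedCategory B]
    [HasDerivedCategory (QuiverRep V A)] [HasDerivedCategory (QuiverRep V B)] :
    (∃ RFV : DerivedCategory.Plus (QuiverRep V A) ⥤ DerivedCategory.Plus (QuiverRep V B),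
      (F.quiverRep V).IsRightDerivedFunctorPlus RFV) ∧
    ∀ RFV : DerivedCategory.Plus (QuiverRep V A) ⥤ DerivedCategory.Plus (QuiverRep V B),
      (F.quiverRep V).IsRightDerivedFunctorPlus RFV →
        (F.rightDerivedFunctorPlus.IsEquivalence → RFV.IsEquivalence) ∧
        (F.rightDerivedFunctorPlus.InducesBoundedEquivalence →
          RFV.InducesBoundedEquivalence) := by
  refine ⟨F.exists_isRightDerivedFunctorPlus_quiverRep V, fun RFV hRFV ↦ ⟨fun h ↦ ?_, fun h ↦ ?_⟩⟩
  · rw [← Plus.restrictsToEquivalence_boundedIf_false_iff] at h ⊢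
    exact Functor.IsDerivedEquivalence.quiverRep h RFV hRFV
  · rw [← Plus.restrictsToEquivalence_boundedIf_true_iff] at h ⊢
    exact Functor.IsDerivedEquivalence.quiverRep h RFV hRFV
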